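/- A \emph{cube complex} is a polyhedral complex whose cells are Euclidean unit cubes, glued along faces by isometries, such that any two cubes that meet do so in a common face of each. It is \emph{finite-dimensional} if the dimensions of its cubes are bounded, and it is a \emph{CAT(0) cube complex} if its underlying topological space is simply connected (in particular non-empty and connected) and it satisfies Gromov's link condition: in the link of each vertex, every finite set of pairwise adjacent vertices spans a simplex. A discrete metric space $(V,\rho)$ has \emph{Property A} if for all $R,\varepsilon>0$ there exist a map $\xi\colon V\to\ell^1(V)$ and a number $S>0$ such that $\|\xi(x)\|_1=1$ for all $x\in V$; $\|\xi(x)-\xi(y)\|_1\le\varepsilon$ for all $x,y\in V$ with $\rho(x,y)\le R$; and, for each $x\in V$, $\xi(x)$ is supported in the closed ball $B(x;S)$. \textbf{Proposition.} Let $X$ be a finite-dimensional CAT(0) cube complex (not necessarily locally finite). Then $X$ has Property A; that is, its vertex set, equipped with the edge-path metric, has Property A. -/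

import Mathlib

/-- The face of the vertex set `{0,1}ⁿ` of the standard `n`-cube on which the coordinates in `S`
are frozen to the values prescribed by `y`, the other coordinates being free. -/
def cubeFace {n : ℕ} (S : Set (Fin n)) (y : Fin n → Bool) : Set (Fin n → Bool) :=
  {x | ∀ i ∈ S, x i = y i}

/-- A cubical chart with respect to a family `K` of subsets of `V` (the vertex sets of the cubes):
an injective labelling of the vertices of the standard `n`-cube by elements of `V`, such that the
members of `K` inside its image are exactly the images of the faces of the standard cube. -/
def IsCubeChart {V : Type*} (K : Set (Set V)) {n : ℕ} (φ : (Fin n → Bool) → V) : Prop :=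
  Function.Injective φ ∧
    ∀ D : Set V, D ⊆ Set.range φ →
      (D ∈ K ↔ ∃ (S : Set (Fin n)) (y : Fin n → Bool), D = φ '' cubeFace S y)

/-- A cube complex with vertex set `V`. Since any two cubes meet, if at all, in a common face, a
cube is determined by its vertex set; so the complex is recorded by the family of the vertex sets
of its cubes (of all dimensions). Each vertex is a `0`-cube, each cube is a copy of a standard cube
whose faces are exactly the cubes contained in it, and two cubes that meet do so in a common face
(a cube contained in `C` being a face of `C`). -/
structure CubeComplex (V : Type*) where
  /-- The vertex sets of the cubes. -/
  cubes : Set (Set V)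
  singleton_mem : ∀ v : V, {v} ∈ cubes
  exists_chart : ∀ C ∈ cubes, ∃ (n : ℕ) (φ : (Fin n → Bool) → V),
    Set.range φ = C ∧ IsCubeChart cubes φ
  inter_mem : ∀ C ∈ cubes, ∀ D ∈ cubes, (C ∩ D).Nonempty → C ∩ D ∈ cubes

namespace CubeComplex

/-- A parametrised cube of the complex. -/
structure Cell {V : Type*} (X : CubeComplex V) where
  /-- The dimension of the cube. -/
  dim : ℕ
  /-- The vertices of the cube, labelled by `{0,1}ⁿ`. -/
  vertex : (Fin dim → Bool) → V
  isChart : IsCubeChart X.cubes vertex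

/-- The point with coordinates `t ∈ [0,1]ⁿ` of a cube, written through its weights on the vertices:
the corner `x ∈ {0,1}ⁿ` has weight `∏ᵢ (tᵢ if xᵢ = 1, else 1 - tᵢ)`. Weights determine `t`, a corner
has weight one on itself, and a point of a face has the same weights in the face as in the cube. -/
noncomputable def Cell.weight {V : Type*} {X : CubeComplex V} (c : X.Cell)
    (t : Fin c.dim → unitInterval) (v : V) : ℝ :=
  open Classical in
  ∑ x : Fin c.dim → Bool,
    if c.vertex x = v then ∏ i, (if x i = true then (t i : ℝ) else 1 - (t i : ℝ)) else 0

/-- The underlying space of the complex: the unit cubes `[0,1]ⁿ`, one for each parametrised cube,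
with points identified when they have the same weights on the vertices (that is, glued along common
faces). -/
def Realization {V : Type*} (X : CubeComplex V) : Type _ :=
  {w : V → ℝ // ∃ (c : X.Cell) (t : Fin c.dim → unitInterval), c.weight t = w}

/-- The characteristic map `[0,1]ⁿ → |X|` of a parametrised cube. -/
noncomputable def Cell.charMap {V : Type*} {X : CubeComplex V} (c : X.Cell)
    (t : Fin c.dim → unitInterval) : X.Realization :=
  ⟨c.weight t, c, t, rfl⟩

/-- The cell-complex topology: a set is open iff its preimage in each cube `[0,1]ⁿ` is open. -/
noncomputable instance {V : Type*} (X : CubeComplex V) : TopologicalSpace X.Realization :=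
  ⨆ c : X.Cell, TopologicalSpace.coinduced c.charMap inferInstance

/-- The graph formed by the vertices and the edges (one-dimensional cubes). -/
def edgeGraph {V : Type*} (X : CubeComplex V) : SimpleGraph V where
  Adj u v := u ≠ v ∧ {u, v} ∈ X.cubes
  symm := ⟨fun u v h => ⟨h.1.symm, by rw [Set.pair_comm]; exact h.2⟩⟩
  loopless := ⟨fun _ h => h.1 rfl⟩

/-- The link of the vertex `v`, as the family of its simplices (including the empty one). Its
vertices are the edges at `v`, represented by their other endpoints, and each cube `C` containing
`v` contributes the simplex of the edges of `C` at `v`. -/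
def link {V : Type*} (X : CubeComplex V) (v : V) : Set (Set V) :=
  {A | ∃ C ∈ X.cubes, v ∈ C ∧ A = {u | u ∈ C ∧ X.edgeGraph.Adj v u}}

/-- Gromov's link condition: every vertex link is a flag complex, that is, any finite set of
pairwise adjacent vertices of the link spans a simplex (`u = w` says that `u` is a vertex). -/
def LinkCondition {V : Type*} (X : CubeComplex V) : Prop :=
  ∀ v : V, ∀ A : Set V, A.Finite → (∀ u ∈ A, ∀ w ∈ A, {u, w} ∈ X.link v) → A ∈ X.link v

/-- A CAT(0) cube complex: simply connected, with Gromov's link condition. -/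
structure IsCAT0 {V : Type*} (X : CubeComplex V) : Prop where
  simplyConnected : SimplyConnectedSpace X.Realization
  linkCondition : X.LinkCondition

/-- The dimensions of the cubes are bounded. -/
def IsFiniteDimensional {V : Type*} (X : CubeComplex V) : Prop :=
  ∃ d : ℕ, ∀ c : X.Cell, c.dim ≤ d

end CubeComplex

/-- The edge-path metric on the vertices of a connected graph. -/
noncomputable abbrev edgePathMetric {V : Type*} {G : SimpleGraph V} (hG : G.Connected) :
    MetricSpace V where
  dist u v := (G.dist u v : ℝ)
  dist_self u := by simp
  dist_comm u v := by rw [SimpleGraph.dist_comm]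
  dist_triangle u v w := by exact_mod_cast hG.dist_triangle
  eq_of_dist_eq_zero {u v} h := by
    have h' : G.dist u v = 0 := by exact_mod_cast h
    exact hG.dist_eq_zero_iff.mp h'

/-- Yu's Property A, through maps into the unit sphere of `ℓ¹(X)`. -/
def HasPropertyA (X : Type*) [MetricSpace X] : Prop :=
  ∀ R > (0 : ℝ), ∀ ε > (0 : ℝ), ∃ ξ : X → lp (fun _ : X => ℝ) 1,
    (∀ x, ‖ξ x‖ = 1) ∧
    (∀ x y, dist x y ≤ R → ‖ξ x - ξ y‖ ≤ ε) ∧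
    ∃ S > (0 : ℝ), ∀ x, Function.support (ξ x : X → ℝ) ⊆ Metric.closedBall x S

/-!
Reduced edge paths towards a fixed vertex `o`, taken up to swaps across squares, form a local system
on the vertices. By the link condition it is trivial around squares, so it extends to a covering of
the realization, which has a section because the realization is simply connected. Hence reduced
paths are unique up to swaps, are geodesic, and the edge graph is a median graph.

In a median graph, a vertex `x` is determined by the set of halfspaces separating it from `o`. Take
the normal cube path from `x` to `o`: each step crosses all the hyperplanes adjacent to the current
vertex at once. Let the shadow of `x` consist of the vertices reached after `l` steps from the
points near `x`. Shadows lie in balls of radius `O(l)` in the interval from `x` to `o`, which in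
bounded dimension have only polynomially many points, and the shadows of nearby points are
interleaved. Averaging the uniform distributions on shadows of increasing width, the variation
between nearby points telescopes to a difference of logarithms of cardinalities divided by `l`,
hence tends to zero.
-/

section PropertyA

open Filter Asymptotics Finset

variable {V : Type*}

section EllOne

variable {f g : lp (fun _ : V => ℝ) 1}

theorem lp_one_summable (f : lp (fun _ : V => ℝ) 1) : Summable f := by
  refine Summable.of_norm ?_
  simpa using (lp.memℓp f).summable (by simp)

theorem lp_one_norm_of_nonneg (hf : ∀ v, 0 ≤ f v) : ‖f‖ = ∑' v, f v := by
  rw [lp.norm_eq_tsum_rpow (by simp)]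
  simp only [ENNReal.toReal_one, Real.rpow_one, div_one, Real.norm_of_nonneg (hf _)]

theorem lp_one_norm_add_of_nonneg (hf : ∀ v, 0 ≤ f v) (hg : ∀ v, 0 ≤ g v) :
    ‖f + g‖ = ‖f‖ + ‖g‖ := by
  rw [lp_one_norm_of_nonneg hf, lp_one_norm_of_nonneg hg,
    ← (lp_one_summable f).tsum_add (lp_one_summable g)]
  exact lp_one_norm_of_nonneg fun v => add_nonneg (hf v) (hg v)

theorem lp_one_norm_sub_of_le (hg : ∀ v, 0 ≤ g v) (hgf : ∀ v, g v ≤ f v) :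
    ‖f - g‖ = ‖f‖ - ‖g‖ := by
  have hadd := lp_one_norm_add_of_nonneg (f := f - g) (fun v => sub_nonneg.2 (hgf v)) hg
  rw [sub_add_cancel] at hadd
  linarith

theorem lp_one_norm_sum_of_nonneg {ι : Type*} {s : Finset ι} {f : ι → lp (fun _ : V => ℝ) 1}
    (hf : ∀ i ∈ s, ∀ v, 0 ≤ f i v) : ‖∑ i ∈ s, f i‖ = ∑ i ∈ s, ‖f i‖ := by
  classical
  induction s using Finset.induction_on with
  | empty => simp
  | insert i s hi ih =>
    rw [forall_mem_insert] at hf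
    rw [sum_insert hi, sum_insert hi, ← ih hf.2, lp_one_norm_add_of_nonneg hf.1]
    intro v
    rw [lp.coeFn_sum, Finset.sum_apply]
    exact sum_nonneg fun j hj => hf.2 j hj v

end EllOne

/-- The uniform probability distribution on a finite set, as an element of `ℓ¹`. -/
noncomputable def uniformDist (A : Finset V) : lp (fun _ : V => ℝ) 1 :=
  ⟨(A : Set V).indicator fun _ => (#A : ℝ)⁻¹, memℓp_gen <|
    summable_of_ne_finset_zero (s := A) fun v hv => by simp [hv]⟩

section UniformDist

variable {A B C D : Finset V} {v : V}

theorem coe_uniformDist (A : Finset V) :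
    (uniformDist A : V → ℝ) = (A : Set V).indicator fun _ => (#A : ℝ)⁻¹ := by
  rw [uniformDist]

theorem uniformDist_apply_of_mem (hv : v ∈ A) : uniformDist A v = (#A : ℝ)⁻¹ := by
  rw [coe_uniformDist, Set.indicator_of_mem (mem_coe.2 hv)]

theorem uniformDist_apply_of_notMem (hv : v ∉ A) : uniformDist A v = 0 := by
  rw [coe_uniformDist, Set.indicator_of_notMem (mem_coe.not.2 hv)]

theorem uniformDist_nonneg (A : Finset V) (v : V) : 0 ≤ uniformDist A v := by
  rw [coe_uniformDist]
  exact Set.indicator_nonneg (fun _ _ => by positivity) v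

theorem norm_uniformDist (hA : A.Nonempty) : ‖uniformDist A‖ = 1 := by
  have hcard : (#A : ℝ) ≠ 0 := by exact_mod_cast hA.card_pos.ne'
  rw [lp_one_norm_of_nonneg (uniformDist_nonneg A)]
  calc ∑' v, uniformDist A v = ∑ v ∈ A, uniformDist A v :=
        tsum_eq_sum fun v hv => uniformDist_apply_of_notMem hv
    _ = ∑ _v ∈ A, (#A : ℝ)⁻¹ := sum_congr rfl fun _ hv => uniformDist_apply_of_mem hv
    _ = 1 := by rw [sum_const, nsmul_eq_mul, mul_inv_cancel₀ hcard]

theorem card_div_card_mul_uniformDist_le (hC : C.Nonempty) (hCA : C ⊆ A) (hAD : A ⊆ D) (v : V) :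
    (#C / #D : ℝ) * uniformDist C v ≤ uniformDist A v := by
  by_cases hv : v ∈ C
  · have hc : (#C : ℝ) ≠ 0 := by exact_mod_cast hC.card_pos.ne'
    have ha : (0 : ℝ) < #A := by exact_mod_cast (hC.mono hCA).card_pos
    rw [uniformDist_apply_of_mem hv, uniformDist_apply_of_mem (hCA hv), div_mul_eq_mul_div,
      mul_inv_cancel₀ hc, one_div]
    gcongr
  · rw [uniformDist_apply_of_notMem hv, mul_zero]
    exact uniformDist_nonneg A v

theorem norm_uniformDist_sub_smul (hC : C.Nonempty) (hCA : C ⊆ A) (hAD : A ⊆ D) :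
    ‖uniformDist A - (#C / #D : ℝ) • uniformDist C‖ = 1 - #C / #D := by
  have hr : (0 : ℝ) ≤ #C / #D := by positivity
  rw [lp_one_norm_sub_of_le (fun v => mul_nonneg hr (uniformDist_nonneg C v))
    (card_div_card_mul_uniformDist_le hC hCA hAD), norm_smul, norm_uniformDist hC,
    norm_uniformDist (hC.mono hCA), Real.norm_of_nonneg hr, mul_one]

theorem norm_uniformDist_sub_le (hC : C.Nonempty) (hCA : C ⊆ A) (hCB : C ⊆ B) (hAD : A ⊆ D)
    (hBD : B ⊆ D) :
    ‖uniformDist A - uniformDist B‖ ≤ 2 * (Real.log #D - Real.log #C) := by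
  have hc : (0 : ℝ) < #C := by exact_mod_cast hC.card_pos
  have hd : (0 : ℝ) < #D := by exact_mod_cast (hC.mono (hCA.trans hAD)).card_pos
  have hlog := Real.one_sub_inv_le_log_of_pos (div_pos hd hc)
  rw [Real.log_div hd.ne' hc.ne', inv_div] at hlog
  have htri := norm_sub_le_norm_sub_add_norm_sub (uniformDist A)
    ((#C / #D : ℝ) • uniformDist C) (uniformDist B)
  rw [norm_sub_rev (_ • _) (uniformDist B), norm_uniformDist_sub_smul hC hCA hAD,
    norm_uniformDist_sub_smul hC hCB hBD] at htri
  linarith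

end UniformDist

/-- The average of the uniform distributions on `A 0, …, A (n - 1)`. -/
noncomputable def averageUniformDist (A : ℕ → Finset V) (n : ℕ) : lp (fun _ : V => ℝ) 1 :=
  (n : ℝ)⁻¹ • ∑ k ∈ range n, uniformDist (A k)

theorem norm_averageUniformDist {A : ℕ → Finset V} {n : ℕ} (hn : n ≠ 0)
    (hA : ∀ k < n, (A k).Nonempty) : ‖averageUniformDist A n‖ = 1 := by
  rw [averageUniformDist, norm_smul, lp_one_norm_sum_of_nonneg fun k _ => uniformDist_nonneg _,
    sum_congr rfl fun k hk => norm_uniformDist (hA k (mem_range.1 hk))]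
  simp [hn]

theorem support_averageUniformDist_subset (A : ℕ → Finset V) (n : ℕ) :
    Function.support (averageUniformDist A n) ⊆ ⋃ k < n, (A k : Set V) := by
  intro v hv
  contrapose! hv
  simp only [Set.mem_iUnion, mem_coe, not_exists] at hv
  rw [Function.notMem_support, averageUniformDist, lp.coeFn_smul, lp.coeFn_sum, Pi.smul_apply,
    Finset.sum_apply,
    sum_eq_zero fun k hk => uniformDist_apply_of_notMem (hv k (mem_range.1 hk)), smul_zero]

theorem sum_range_sub_shift_le {a : ℕ → ℝ} {L : ℝ} {n m : ℕ} (h0 : ∀ k < m, 0 ≤ a k)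
    (hL : ∀ k < n + m, a k ≤ L) : ∑ k ∈ range n, (a (k + m) - a k) ≤ m * L := by
  have hfirst : 0 ≤ ∑ k ∈ range m, a k := sum_nonneg fun k hk => h0 k (mem_range.1 hk)
  have hlast : ∑ k ∈ range m, a (n + k) ≤ m * L := by
    simpa using sum_le_card_nsmul (range m) _ L fun k hk =>
      hL (n + k) (Nat.add_lt_add_left (mem_range.1 hk) n)
  have hsplit : ∑ k ∈ range n, a k + ∑ k ∈ range m, a (n + k) =
      ∑ k ∈ range m, a k + ∑ k ∈ range n, a (m + k) := by
    rw [← sum_range_add, ← sum_range_add, add_comm n m]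
  simp only [sum_sub_distrib, add_comm _ m]
  linarith

theorem norm_averageUniformDist_sub_le {A B : ℕ → Finset V} {n R p : ℕ}
    (hne : ∀ k < n + 2 * R, (A k).Nonempty) (hcard : ∀ k < n + 2 * R, #(A k) ≤ p)
    (hAA : ∀ k < n + R, A k ⊆ A (k + R)) (hAB : ∀ k < n + R, A k ⊆ B (k + R))
    (hBA : ∀ k < n + R, B k ⊆ A (k + R)) :
    ‖averageUniformDist (fun k => A (k + R)) n - averageUniformDist (fun k => B (k + R)) n‖ ≤
      (n : ℝ)⁻¹ * (2 * ((2 * R : ℕ) * Real.log p)) := by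
  have hterm : ∀ k ∈ range n, ‖uniformDist (A (k + R)) - uniformDist (B (k + R))‖ ≤
      2 * (Real.log #(A (k + 2 * R)) - Real.log #(A k)) := fun k hk => by
    have hkn := mem_range.1 hk
    rw [two_mul R, ← add_assoc]
    exact norm_uniformDist_sub_le (hne k (by lia)) (hAA k (by lia)) (hAB k (by lia))
      (hAA (k + R) (by lia)) (hBA (k + R) (by lia))
  have hlog : ∀ k < n + 2 * R, Real.log #(A k) ≤ Real.log p := fun k hk =>
    Real.log_le_log (by exact_mod_cast (hne k hk).card_pos) (by exact_mod_cast hcard k hk)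
  rw [averageUniformDist, averageUniformDist, ← smul_sub, ← sum_sub_distrib, norm_smul,
    Real.norm_of_nonneg (by positivity)]
  gcongr
  calc ‖∑ k ∈ range n, (uniformDist (A (k + R)) - uniformDist (B (k + R)))‖
      ≤ ∑ k ∈ range n, 2 * (Real.log #(A (k + 2 * R)) - Real.log #(A k)) :=
        norm_sum_le_of_le _ hterm
    _ ≤ 2 * ((2 * R : ℕ) * Real.log p) := by
        rw [← mul_sum]
        gcongr
        exact sum_range_sub_shift_le (a := fun k => Real.log #(A k))
          (fun k _ => Real.log_natCast_nonneg _) hlog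

theorem exists_mul_comp_add_le_of_isLittleO {f : ℕ → ℝ} (hf : f =o[atTop] fun l => (l : ℝ))
    (m : ℕ) {ε : ℝ} (hε : 0 < ε) : ∃ n ≠ 0, m * f (n + m) ≤ ε * n := by
  obtain ⟨N, hN⟩ := eventually_atTop.1 (hf.def (c := ε / (m + 1)) (by positivity))
  let n := N + m ^ 2 + 1
  have hle : f (n + m) ≤ ε / (m + 1) * (n + m : ℕ) := by
    simpa only [Real.norm_natCast] using (le_abs_self _).trans (hN (n + m) (by lia))
  have hmn : m * (n + m) ≤ (m + 1) * n := by
    simp only [n]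
    nlinarith
  refine ⟨n, by simp [n], ?_⟩
  calc m * f (n + m) ≤ m * (ε / (m + 1) * (n + m : ℕ)) := by gcongr
    _ = ε / (m + 1) * (m * (n + m) : ℕ) := by push_cast; ring
    _ ≤ ε / (m + 1) * ((m + 1) * n : ℕ) := by gcongr
    _ = ε * n := by push_cast; field_simp

theorem isLittleO_log_mul_add_one_pow (c d : ℕ) :
    (fun l : ℕ => Real.log ((c * l + 1) ^ d : ℕ)) =o[atTop] fun l => (l : ℝ) := by
  rcases eq_or_ne c 0 with rfl | hc
  · simp
  simp only [Nat.cast_pow, Real.log_pow]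
  refine IsLittleO.const_mul_left ?_ _
  have htop : Tendsto (fun l : ℕ => ((c * l + 1 : ℕ) : ℝ)) atTop atTop :=
    tendsto_natCast_atTop_atTop.comp <| (tendsto_add_atTop_nat 1).comp <|
      tendsto_id.const_mul_atTop' (Nat.pos_of_ne_zero hc)
  refine (Real.isLittleO_log_id_atTop.comp_tendsto htop).trans_isBigO ?_
  refine IsBigO.of_bound (c + 1) (eventually_atTop.2 ⟨1, fun l hl => ?_⟩)
  have hl' : (1 : ℝ) ≤ l := by exact_mod_cast hl
  simp only [Function.comp_apply, id_eq, Real.norm_natCast]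
  push_cast
  linarith

theorem hasPropertyA_of_interleaved [MetricSpace V] {S : ℕ → V → ℕ → Set V} {p : ℕ → ℕ}
    (hp : (fun l => Real.log (p l)) =o[atTop] fun l => (l : ℝ))
    (hne : ∀ l x, ∀ k ≤ l, (S l x k).Nonempty)
    (hfin : ∀ l x, ∀ k ≤ l, (S l x k).Finite ∧ (S l x k).ncard ≤ p l)
    (hsub : ∀ l x y k (R : ℕ), dist x y ≤ R → S l x k ⊆ S l y (k + R))
    (hball : ∀ l, ∃ s, ∀ x, ∀ k ≤ l, S l x k ⊆ Metric.closedBall x s) :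
    HasPropertyA V := by
  intro R₀ _ ε hε
  let R := ⌈R₀⌉₊
  obtain ⟨n, hn, hlog⟩ := exists_mul_comp_add_le_of_isLittleO hp (2 * R) (half_pos hε)
  let l := n + 2 * R
  have hfinset : ∀ x k, ∃ A : Finset V, k ≤ l → (A : Set V) = S l x k := fun x k => by
    by_cases hk : k ≤ l
    · exact ⟨(hfin l x k hk).1.toFinset, fun _ => by simp⟩
    · exact ⟨∅, fun h => absurd h hk⟩
  choose A hA using hfinset
  have hAne : ∀ x, ∀ k ≤ l, (A x k).Nonempty := fun x k hk => by
    rw [← coe_nonempty, hA x k hk]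
    exact hne l x k hk
  have hAcard : ∀ x, ∀ k ≤ l, #(A x k) ≤ p l := fun x k hk => by
    rw [← Set.ncard_coe_finset, hA x k hk]
    exact (hfin l x k hk).2
  have hAsub : ∀ x y k, dist x y ≤ R → k + R ≤ l → A x k ⊆ A y (k + R) := fun x y k hxy hk => by
    rw [← coe_subset, hA x k (by lia), hA y _ hk]
    exact hsub l x y k R hxy
  refine ⟨fun x => averageUniformDist (fun k => A x (k + R)) n, fun x => ?_, fun x y hxy => ?_, ?_⟩
  · exact norm_averageUniformDist hn fun k hk => hAne x _ (by lia)
  · beta_reduce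
    have hxy' : dist x y ≤ R := hxy.trans (Nat.le_ceil R₀)
    have hbound := norm_averageUniformDist_sub_le (n := n) (R := R) (A := A x) (B := A y)
      (fun k hk => hAne x k hk.le) (fun k hk => hAcard x k hk.le)
      (fun k hk => hAsub x x k (by simp) (by lia)) (fun k hk => hAsub x y k hxy' (by lia))
      (fun k hk => hAsub y x k (by rwa [dist_comm]) (by lia))
    refine hbound.trans ?_
    have hn' : (0 : ℝ) < n := by positivity
    rw [inv_mul_le_iff₀ hn']
    linarith
  · obtain ⟨s, hs⟩ := hball l
    refine ⟨max s 1, by positivity, fun x => (support_averageUniformDist_subset _ n).trans ?_⟩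
    refine Set.iUnion₂_subset fun k hk => ?_
    rw [hA x _ (by lia)]
    exact (hs x _ (by lia)).trans (Metric.closedBall_subset_closedBall (le_max_left s 1))

end PropertyA

section MedianGraph

variable {V : Type*} {G : SimpleGraph V} {a b c d o u v w x y z : V}

/-- `a`, `b`, `c`, `d` are, in this cyclic order, the vertices of a cycle of length four. -/
structure IsFourCycle (G : SimpleGraph V) (a b c d : V) : Prop where
  ne_ac : a ≠ c
  ne_bd : b ≠ d
  adj_ab : G.Adj a b
  adj_bc : G.Adj b c
  adj_cd : G.Adj c d
  adj_da : G.Adj d a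

namespace IsFourCycle

theorem rotate (h : IsFourCycle G a b c d) : IsFourCycle G b c d a :=
  ⟨h.ne_bd, h.ne_ac.symm, h.adj_bc, h.adj_cd, h.adj_da, h.adj_ab⟩

theorem reflect (h : IsFourCycle G a b c d) : IsFourCycle G a d c b :=
  ⟨h.ne_ac, h.ne_bd.symm, h.adj_da.symm, h.adj_cd.symm, h.adj_bc.symm, h.adj_ab.symm⟩

end IsFourCycle

/-- Median graphs, through their local-to-global characterization: the connected graphs in which
adjacent vertices are never equidistant from a third one (bipartiteness), in which two neighbours
of a vertex `a` that are closer than `a` to a vertex `o` have a common neighbour still closer to `o`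
(the quadrangle condition), and which contain no `K_{2,3}`. -/
structure IsMedianGraph (G : SimpleGraph V) : Prop where
  connected : G.Connected
  dist_ne : ∀ o {u v}, G.Adj u v → G.dist u o ≠ G.dist v o
  exists_fourCycle : ∀ o {a v w}, G.Adj a v → G.Adj a w → v ≠ w → G.dist v o < G.dist a o →
    G.dist w o < G.dist a o → ∃ b, IsFourCycle G a v b w ∧ G.dist b o < G.dist v o
  fourCycle_unique : ∀ {a b c d d'}, IsFourCycle G a b c d → IsFourCycle G a b c d' → d = d'

/-- The cubes of a median graph have dimension at most `n`. Edges at a vertex that pairwise span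
squares span a cube, so this is stated as a bound on the number of such edges. -/
def CubeDimLE (G : SimpleGraph V) (n : ℕ) : Prop :=
  ∀ (v : V) (A : Finset V), (∀ u ∈ A, G.Adj v u) →
    (A : Set V).Pairwise (fun u w => ∃ b, IsFourCycle G v u b w) → A.card ≤ n

/-- The vertices that are closer to `u` than to `v`. When `u` and `v` are adjacent vertices of a
median graph, this is one of the two sides of the hyperplane dual to the edge `uv`. -/
def halfspace (G : SimpleGraph V) (u v : V) : Set V :=
  {z | G.dist u z < G.dist v z}

theorem mem_halfspace : z ∈ halfspace G u v ↔ G.dist u z < G.dist v z := Iff.rfl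

theorem left_mem_halfspace (h : G.Adj u v) : u ∈ halfspace G u v := by
  rw [mem_halfspace, SimpleGraph.dist_self, SimpleGraph.dist_eq_one_iff_adj.2 h.symm]
  exact one_pos

theorem right_notMem_halfspace : v ∉ halfspace G u v := by
  simp [mem_halfspace]

/-- The halfspaces that contain `x` but not `y`. -/
def separators (G : SimpleGraph V) (x y : V) : Set (Set V) :=
  {h | (∃ u v, G.Adj u v ∧ h = halfspace G u v) ∧ x ∈ h ∧ y ∉ h}

/-- The minimal halfspaces that contain `x` but not `y`: the hyperplanes separating `x` from `y`
that are dual to an edge at `x`. -/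
def minSeparators (G : SimpleGraph V) (x y : V) : Set (Set V) :=
  {h | Minimal (· ∈ separators G x y) h}

/-- The maximal halfspaces that contain `x` but not `y`: the hyperplanes separating `x` from `y`
that are dual to an edge at `y`. -/
def maxSeparators (G : SimpleGraph V) (x y : V) : Set (Set V) :=
  {h | Maximal (· ∈ separators G x y) h}

theorem separators_self (x : V) : separators G x x = ∅ :=
  Set.eq_empty_of_forall_notMem fun _ h => h.2.2 h.2.1

theorem separators_sdiff_subset (x z o : V) :
    separators G x o \ separators G z o ⊆ separators G x z :=
  fun _ h => ⟨h.1.1, h.1.2.1, fun hz => h.2 ⟨h.1.1, hz, h.1.2.2⟩⟩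

theorem halfspace_mem_separators (h : G.Adj x y) (hlt : G.dist y o < G.dist x o) :
    halfspace G x y ∈ separators G x o :=
  ⟨⟨x, y, h, rfl⟩, left_mem_halfspace h, hlt.not_gt⟩

theorem halfspace_notMem_separators : halfspace G x y ∉ separators G y o :=
  fun h => right_notMem_halfspace h.2.1

theorem exists_adj_dist_lt (hG : G.Connected) (h : u ≠ o) :
    ∃ v, G.Adj u v ∧ G.dist v o < G.dist u o := by
  obtain ⟨p, hp⟩ := hG.exists_walk_length_eq_dist u o
  cases p with
  | nil => exact absurd rfl h
  | cons h' p =>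
    refine ⟨_, h', ?_⟩
    rw [← hp, SimpleGraph.Walk.length_cons]
    exact Nat.lt_succ_of_le (SimpleGraph.dist_le p)

namespace IsMedianGraph

section Halfspaces

variable (hG : IsMedianGraph G)
include hG

theorem dist_eq_or (o : V) (h : G.Adj u v) :
    G.dist u o = G.dist v o + 1 ∨ G.dist v o = G.dist u o + 1 := by
  have hne := hG.dist_ne o h
  have hdiff := h.diff_dist_adj (u := o)
  simp only [G.dist_comm (u := o)] at hdiff
  lia

theorem compl_halfspace (h : G.Adj u v) : (halfspace G u v)ᶜ = halfspace G v u := by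
  ext z
  rw [Set.mem_compl_iff, mem_halfspace, mem_halfspace]
  have := hG.dist_ne z h
  lia

theorem halfspace_subset_of_fourCycle (s : IsFourCycle G a b c d) :
    halfspace G a b ⊆ halfspace G d c := by
  intro z hz
  rw [mem_halfspace] at hz ⊢
  by_contra hcd
  have hbc := hG.dist_eq_or z s.adj_bc
  have hcd' := hG.dist_eq_or z s.adj_cd
  have hda := hG.dist_eq_or z s.adj_da
  obtain ⟨e, s', he⟩ := hG.exists_fourCycle z s.adj_ab.symm s.adj_bc s.ne_ac (by lia) (by lia)
  obtain rfl := hG.fourCycle_unique s'.rotate.rotate.rotate s.reflect.rotate.rotate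
  lia

theorem halfspace_eq_of_fourCycle (s : IsFourCycle G a b c d) :
    halfspace G a b = halfspace G d c :=
  (hG.halfspace_subset_of_fourCycle s).antisymm
    (hG.halfspace_subset_of_fourCycle s.reflect.rotate)

theorem exists_crossing_closer (huv : G.Adj u v) (hab : G.Adj a b) (ha : a ∈ halfspace G u v)
    (hb : b ∉ halfspace G u v) (hbv : b ≠ v) :
    ∃ c e, IsFourCycle G a b e c ∧ c ∈ halfspace G u v ∧ e ∉ halfspace G u v ∧
      G.dist c u < G.dist a u := by
  simp only [mem_halfspace, G.dist_comm (u := u), G.dist_comm (u := v)] at ha hb ⊢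
  obtain ⟨e, hbe, hlt⟩ := exists_adj_dist_lt hG.connected hbv
  have hav := hG.dist_eq_or v hab
  have heu := hG.dist_eq_or u hbe
  have hev := hG.dist_eq_or v hbe
  have huva := hG.dist_eq_or a huv
  have huvb := hG.dist_eq_or b huv
  have huve := hG.dist_eq_or e huv
  simp only [G.dist_comm (u := u), G.dist_comm (u := v)] at huva huvb huve
  obtain ⟨c, s, hc⟩ := hG.exists_fourCycle u hab.symm hbe (by rintro rfl; lia) (by lia) (by lia)
  have hcv := hG.dist_eq_or v s.adj_bc
  exact ⟨c, e, s.reflect.rotate.rotate.rotate, by lia, by lia, hc⟩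

theorem halfspace_eq_of_crossing (huv : G.Adj u v) (hab : G.Adj a b) (ha : a ∈ halfspace G u v)
    (hb : b ∉ halfspace G u v) : halfspace G a b = halfspace G u v := by
  induction hn : G.dist a u using Nat.strong_induction_on generalizing a b with
  | _ n ih =>
    by_cases hbv : b = v
    · subst hbv
      have hua : G.dist u a = 0 := by
        rw [mem_halfspace, SimpleGraph.dist_eq_one_iff_adj.2 hab.symm] at ha
        lia
      rw [hG.connected.dist_eq_zero_iff.1 hua]
    · obtain ⟨c, e, s, hc, he, hlt⟩ := hG.exists_crossing_closer huv hab ha hb hbv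
      exact (hG.halfspace_eq_of_fourCycle s).trans (ih _ (hn ▸ hlt) s.adj_cd.symm hc he rfl)

theorem eq_halfspace_of_crossing {h : Set V} (hh : h ∈ separators G x y) (hab : G.Adj a b)
    (ha : a ∈ h) (hb : b ∉ h) : h = halfspace G a b := by
  obtain ⟨⟨u, v, huv, rfl⟩, -⟩ := hh
  exact (hG.halfspace_eq_of_crossing huv hab ha hb).symm

theorem compl_mem_separators {h : Set V} (hh : h ∈ separators G x y) :
    hᶜ ∈ separators G y x := by
  obtain ⟨⟨u, v, huv, rfl⟩, hx, hy⟩ := hh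
  exact ⟨⟨v, u, huv.symm, hG.compl_halfspace huv⟩, hy, fun h => h hx⟩

theorem separators_eq_insert (h : G.Adj x y) (hlt : G.dist y o < G.dist x o) :
    separators G x o = insert (halfspace G x y) (separators G y o) := by
  ext k
  constructor
  · intro hk
    by_cases hy : y ∈ k
    · exact Or.inr ⟨hk.1, hy, hk.2.2⟩
    · exact Or.inl (hG.eq_halfspace_of_crossing hk h hk.2.1 hy)
  · rintro (rfl | hk)
    · exact halfspace_mem_separators h hlt
    · refine ⟨hk.1, ?_, hk.2.2⟩
      by_contra hx
      have hkyx := hG.eq_halfspace_of_crossing hk h.symm hk.2.1 hx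
      exact hk.2.2 (hkyx ▸ hlt)

theorem finite_separators_and_ncard (x o : V) :
    (separators G x o).Finite ∧ (separators G x o).ncard = G.dist x o := by
  induction hn : G.dist x o using Nat.strong_induction_on generalizing x with
  | _ n ih =>
    rcases eq_or_ne x o with rfl | hx
    · simp [separators_self, ← hn]
    · obtain ⟨y, hxy, hlt⟩ := exists_adj_dist_lt hG.connected hx
      obtain ⟨hfin, hcard⟩ := ih _ (hn ▸ hlt) y rfl
      rw [hG.separators_eq_insert hxy hlt,
        Set.ncard_insert_of_notMem halfspace_notMem_separators hfin, hcard]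
      have hdist := hG.dist_eq_or o hxy
      exact ⟨hfin.insert _, by lia⟩

theorem finite_separators (x o : V) : (separators G x o).Finite :=
  (hG.finite_separators_and_ncard x o).1

theorem ncard_separators (x o : V) : (separators G x o).ncard = G.dist x o :=
  (hG.finite_separators_and_ncard x o).2

theorem eq_of_separators_eq_empty (h : separators G x y = ∅) : x = y := by
  rw [← hG.connected.dist_eq_zero_iff, ← hG.ncard_separators, h, Set.ncard_empty]

theorem separators_sdiff_eq (h : separators G z o ⊆ separators G x o) :
    separators G x o \ separators G z o = separators G x z := by
  refine (separators_sdiff_subset x z o).antisymm fun k hk => ⟨⟨hk.1, hk.2.1, fun ho => ?_⟩,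
    fun hz => hk.2.2 hz.2.1⟩
  exact (h ⟨(hG.compl_mem_separators hk).1, hk.2.2, fun hko => hko ho⟩).2.1 hk.2.1

theorem separators_left_injective (o : V) : Function.Injective (separators G · o) :=
  fun x z (h : separators G x o = separators G z o) =>
    hG.eq_of_separators_eq_empty <| by rw [← hG.separators_sdiff_eq h.ge, h, Set.sdiff_self]

end Halfspaces

section MinSeparators

variable (hG : IsMedianGraph G) {n : ℕ} (hn : CubeDimLE G n)
include hG

theorem mem_minSeparators_of_adj {h : Set V} (hxy : G.Adj x y) (hlt : G.dist y o < G.dist x o)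
    (hh : h ∈ minSeparators G x o) (hne : h ≠ halfspace G x y) : h ∈ minSeparators G y o := by
  have hins := hG.separators_eq_insert hxy hlt
  exact Minimal.mono hh (fun k hk => hins ▸ Or.inr hk) ((hins ▸ hh.prop).resolve_left hne)

theorem exists_adj_of_mem_minSeparators {h : Set V} (hh : h ∈ minSeparators G x o) :
    ∃ y, G.Adj x y ∧ G.dist y o < G.dist x o ∧ h = halfspace G x y := by
  induction hn : G.dist x o using Nat.strong_induction_on generalizing x with
  | _ n ih =>
    have hxo : x ≠ o := fun e => hh.prop.2.2 (e ▸ hh.prop.2.1)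
    obtain ⟨y, hxy, hlt⟩ := exists_adj_dist_lt hG.connected hxo
    by_cases hk : h = halfspace G x y
    · exact ⟨y, hxy, hn ▸ hlt, hk⟩
    obtain ⟨z, hyz, hlt', rfl⟩ :=
      ih _ (hn ▸ hlt) (hG.mem_minSeparators_of_adj hxy hlt hh hk) rfl
    obtain ⟨w, hwx, hwy⟩ := Set.not_subset.1 fun hsub =>
      hk (hh.eq_of_superset (halfspace_mem_separators hxy hlt) hsub)
    rw [mem_halfspace] at hwx hwy
    have hwz := hG.dist_ne w hyz
    -- Seen from `w`, both `x` and `z` are closer than `y`.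
    obtain ⟨c, s, -⟩ :=
      hG.exists_fourCycle w hxy.symm hyz (by rintro rfl; lia) hwx (by lia)
    have hxc : halfspace G x c = halfspace G y z := hG.halfspace_eq_of_fourCycle s.rotate
    have ho : o ∉ halfspace G x c := hxc ▸ hh.prop.2.2
    rw [mem_halfspace] at ho
    have hco := hG.dist_ne o s.adj_bc
    exact ⟨c, s.adj_bc, by lia, hxc.symm⟩

theorem finite_minSeparators (x o : V) : (minSeparators G x o).Finite :=
  (hG.finite_separators x o).subset fun _ h => h.prop

theorem compl_mem_minSeparators {h : Set V} (hh : h ∈ maxSeparators G x y) :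
    hᶜ ∈ minSeparators G y x := by
  refine ⟨hG.compl_mem_separators hh.prop, fun k hk hkh => ?_⟩
  exact Set.compl_subset_comm.1 <|
    hh.le_of_ge (hG.compl_mem_separators hk) (Set.subset_compl_comm.1 hkh)

theorem exists_separators_eq_sdiff (o : V) (M : Finset (Set V)) (x : V)
    (hM : ↑M ⊆ minSeparators G x o) : ∃ z, separators G z o = separators G x o \ M := by
  classical
  induction M using Finset.induction_on generalizing x with
  | empty => exact ⟨x, by simp⟩
  | insert h M hhM ih =>
    rw [Finset.coe_insert, Set.insert_subset_iff] at hM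
    obtain ⟨y, hxy, hlt, rfl⟩ := hG.exists_adj_of_mem_minSeparators hM.1
    obtain ⟨z, hz⟩ := ih y fun k hk =>
      hG.mem_minSeparators_of_adj hxy hlt (hM.2 hk) (ne_of_mem_of_not_mem hk hhM)
    refine ⟨z, ?_⟩
    rw [hz, hG.separators_eq_insert hxy hlt, Finset.coe_insert,
      Set.insert_sdiff_of_mem _ (Set.mem_insert _ _), ← Set.union_singleton, Set.union_comm,
      ← Set.sdiff_sdiff, Set.sdiff_singleton_eq_self halfspace_notMem_separators]

theorem exists_separators_eq_sdiff_minSeparators (o x : V) :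
    ∃ z, separators G z o = separators G x o \ minSeparators G x o := by
  simpa using hG.exists_separators_eq_sdiff o (hG.finite_minSeparators x o).toFinset x (by simp)

include hn

theorem ncard_minSeparators_le (x o : V) : (minSeparators G x o).ncard ≤ n := by
  classical
  have : Nonempty V := ⟨o⟩
  choose! f hadj hlt hhalf using
    fun h => hG.exists_adj_of_mem_minSeparators (x := x) (o := o) (h := h)
  have hinj : Set.InjOn f (minSeparators G x o) := fun h hh k hk e => by
    rw [hhalf h hh, hhalf k hk, e]
  have hfin := (hG.finite_minSeparators x o).image f
  rw [← hinj.ncard_image, Set.ncard_eq_toFinset_card _ hfin]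
  refine hn x _ ?_ ?_
  · simpa using hadj
  · rw [hfin.coe_toFinset]
    rintro _ ⟨h, hh, rfl⟩ _ ⟨k, hk, rfl⟩ hne
    obtain ⟨b, s, -⟩ :=
      hG.exists_fourCycle o (hadj h hh) (hadj k hk) hne (hlt h hh) (hlt k hk)
    exact ⟨b, s⟩

theorem ncard_maxSeparators_le (x y : V) : (maxSeparators G x y).ncard ≤ n :=
  (Set.ncard_le_ncard_of_injOn compl (fun _ => hG.compl_mem_minSeparators)
    compl_injective.injOn (hG.finite_minSeparators y x)).trans (hG.ncard_minSeparators_le hn y x)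

end MinSeparators

end IsMedianGraph

/-- The vertices on a geodesic from `x` to `o` at distance at most `r` from `x`, `z` lying on such
a geodesic exactly when `z` is not separated from `o` by a halfspace containing `x`. -/
def intervalBall (G : SimpleGraph V) (o x : V) (r : ℕ) : Set V :=
  {z | separators G z o ⊆ separators G x o ∧ G.dist x z ≤ r}

theorem finite_and_ncard_setOf_subset_ncard_le {α : Type*} {B : Set α} (hB : B.Finite) (n : ℕ) :
    {s | s ⊆ B ∧ s.ncard ≤ n}.Finite ∧ {s | s ⊆ B ∧ s.ncard ≤ n}.ncard ≤ (B.ncard + 1) ^ n := by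
  classical
  lift B to Finset α using hB
  have himage : {s : Set α | s ⊆ B ∧ s.ncard ≤ n} ⊆
      (fun t : Finset α => (t : Set α)) ''
        ((Finset.range (n + 1)).biUnion fun i => B.powersetCard i : Finset (Finset α)) := by
    rintro s ⟨hsB, hs⟩
    lift s to Finset α using B.finite_toSet.subset hsB
    rw [Set.ncard_coe_finset] at hs
    exact ⟨s, by simpa [Nat.lt_succ_iff] using ⟨hsB, hs⟩, rfl⟩
  refine ⟨(Set.toFinite _).subset himage, (Set.ncard_le_ncard himage).trans ?_⟩
  refine (Set.ncard_image_le (Finset.finite_toSet _)).trans ?_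
  rw [Set.ncard_coe_finset, Set.ncard_coe_finset, add_pow]
  refine Finset.card_biUnion_le.trans (Finset.sum_le_sum fun i hi => ?_)
  rw [Finset.card_powersetCard, one_pow, mul_one]
  exact (Nat.choose_le_pow ..).trans (Nat.le_mul_of_pos_right _
    (Nat.choose_pos (Nat.le_of_lt_succ (Finset.mem_range.1 hi))))

namespace IsMedianGraph

section NormalStep

variable (hG : IsMedianGraph G) {n : ℕ} (hn : CubeDimLE G n)

/-- The vertex obtained from `x` by crossing simultaneously all hyperplanes that are dual to an edge
at `x` and separate `x` from `o`; its iterates form the normal cube path from `x` to `o`. -/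
noncomputable def normalStep (o x : V) : V :=
  (hG.exists_separators_eq_sdiff_minSeparators o x).choose

/-- The vertices reached by `l` normal steps towards `o` from the ball of radius `k` around `x`. -/
def shadow (o : V) (l : ℕ) (x : V) (k : ℕ) : Set V :=
  (hG.normalStep o)^[l] '' {y | G.dist x y ≤ k}

theorem separators_normalStep (o x : V) :
    separators G (hG.normalStep o x) o = separators G x o \ minSeparators G x o :=
  (hG.exists_separators_eq_sdiff_minSeparators o x).choose_spec

theorem separators_normalStep_subset (o x : V) :
    separators G (hG.normalStep o x) o ⊆ separators G x o := by
  rw [separators_normalStep]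
  exact Set.sdiff_subset

theorem separators_iterate_normalStep_subset_self (o x : V) (l : ℕ) :
    separators G ((hG.normalStep o)^[l] x) o ⊆ separators G x o := by
  induction l generalizing x with
  | zero => exact subset_rfl
  | succ l ih => exact (ih _).trans (hG.separators_normalStep_subset o x)

theorem ncard_separators_normalStep_sdiff_le (o x y : V) :
    (separators G (hG.normalStep o y) o \ separators G x o).ncard ≤
      (separators G y o \ separators G x o).ncard - 1 := by
  have hfin : (separators G y o \ separators G x o).Finite := (hG.finite_separators y o).sdiff
  have hsub : separators G (hG.normalStep o y) o \ separators G x o ⊆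
      separators G y o \ separators G x o :=
    Set.sdiff_subset_sdiff_left (hG.separators_normalStep_subset o y)
  rcases (separators G y o \ separators G x o).eq_empty_or_nonempty with hempty | hne
  · simp [Set.subset_eq_empty hsub hempty]
  · -- A minimal halfspace that has to be crossed is minimal among all separators, because those
    -- containing `x` form an upper set; so the normal step crosses it.
    obtain ⟨h, hh⟩ := hfin.exists_minimal hne
    have hmin : h ∈ minSeparators G y o := ⟨hh.prop.1, fun k hk hkh => hh.le_of_le ⟨hk, fun hkx =>
      hh.prop.2 ⟨hh.prop.1.1, hkh hkx.2.1, hh.prop.1.2.2⟩⟩ hkh⟩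
    refine Nat.le_sub_one_of_lt (Set.ncard_lt_ncard ?_ hfin)
    refine (Set.ssubset_iff_of_subset hsub).2 ⟨h, hh.prop, fun hc => ?_⟩
    exact (hG.separators_normalStep o y ▸ hc.1).2 hmin

theorem ncard_separators_iterate_normalStep_sdiff_le (o x y : V) (l : ℕ) :
    (separators G ((hG.normalStep o)^[l] y) o \ separators G x o).ncard ≤
      (separators G y o \ separators G x o).ncard - l := by
  induction l generalizing y with
  | zero => exact le_rfl
  | succ l ih =>
    have hstep := hG.ncard_separators_normalStep_sdiff_le o x y
    exact (ih (hG.normalStep o y)).trans (by lia)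

theorem separators_iterate_normalStep_subset (o : V) {l : ℕ} (h : G.dist y x ≤ l) :
    separators G ((hG.normalStep o)^[l] y) o ⊆ separators G x o := by
  have hyx : (separators G y o \ separators G x o).ncard ≤ l :=
    ((Set.ncard_le_ncard (separators_sdiff_subset y x o) (hG.finite_separators y x)).trans
      (hG.ncard_separators y x).le).trans h
  have hzero := hG.ncard_separators_iterate_normalStep_sdiff_le o x y l
  rw [Nat.sub_eq_zero_of_le hyx, Nat.le_zero,
    Set.ncard_eq_zero (hG.finite_separators _ o).sdiff] at hzero
  exact Set.sdiff_eq_empty.1 hzero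

theorem shadow_nonempty (o x : V) (l k : ℕ) : (hG.shadow o l x k).Nonempty :=
  ⟨_, x, by simp, rfl⟩

theorem shadow_subset_shadow (o : V) (l k : ℕ) {R : ℕ} (hxy : G.dist x y ≤ R) :
    hG.shadow o l x k ⊆ hG.shadow o l y (k + R) := by
  refine Set.image_mono fun z (hxz : G.dist x z ≤ k) => ?_
  have htri := hG.connected.dist_triangle (u := y) (v := x) (w := z)
  rw [SimpleGraph.dist_comm] at hxy
  exact htri.trans (by lia)

include hG in
theorem separators_subset_of_maxSeparators_eq (h : maxSeparators G x z = maxSeparators G x y) :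
    separators G x z ⊆ separators G x y := by
  intro k hk
  obtain ⟨m, hkm, hm⟩ := (hG.finite_separators x z).exists_le_maximal hk
  have hm' : m ∈ maxSeparators G x y := h ▸ hm
  exact ⟨hk.1, hk.2.1, fun hy => hm'.prop.2.2 (hkm hy)⟩

include hG in
theorem injOn_maxSeparators (o x : V) (r : ℕ) :
    Set.InjOn (maxSeparators G x) (intervalBall G o x r) := by
  intro z hz z' hz' h
  have hsep : separators G x z = separators G x z' :=
    (hG.separators_subset_of_maxSeparators_eq h).antisymm
      (hG.separators_subset_of_maxSeparators_eq h.symm)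
  refine hG.separators_left_injective o ?_
  beta_reduce
  rw [← Set.sdiff_sdiff_cancel_left hz.1, hG.separators_sdiff_eq hz.1, hsep,
    ← hG.separators_sdiff_eq hz'.1, Set.sdiff_sdiff_cancel_left hz'.1]

theorem maxSeparators_subset {r : ℕ} (hz : z ∈ intervalBall G o x r) :
    maxSeparators G x z ⊆ separators G x ((hG.normalStep o)^[r] x) := by
  intro k hk
  have hkz : k ∈ separators G x o \ separators G z o := by
    rw [hG.separators_sdiff_eq hz.1]
    exact hk.prop
  rw [← hG.separators_sdiff_eq (hG.separators_iterate_normalStep_subset_self o x r)]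
  exact ⟨hkz.1, fun h => hkz.2 (hG.separators_iterate_normalStep_subset o hz.2 h)⟩

include hn

theorem dist_normalStep_le (o x : V) : G.dist x (hG.normalStep o x) ≤ n := by
  rw [← hG.ncard_separators, ← hG.separators_sdiff_eq (hG.separators_normalStep_subset o x),
    hG.separators_normalStep, Set.sdiff_sdiff_cancel_left fun _ h => h.prop]
  exact hG.ncard_minSeparators_le hn x o

theorem dist_iterate_normalStep_le (o x : V) (l : ℕ) :
    G.dist x ((hG.normalStep o)^[l] x) ≤ n * l := by
  induction l generalizing x with
  | zero => simp
  | succ l ih =>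
    calc G.dist x ((hG.normalStep o)^[l] (hG.normalStep o x))
        ≤ G.dist x (hG.normalStep o x) +
            G.dist (hG.normalStep o x) ((hG.normalStep o)^[l] (hG.normalStep o x)) :=
          hG.connected.dist_triangle
      _ ≤ n + n * l := add_le_add (hG.dist_normalStep_le hn o x) (ih _)
      _ = n * (l + 1) := by ring

include hG in
theorem intervalBall_finite_and_ncard_le (o x : V) (r : ℕ) :
    (intervalBall G o x r).Finite ∧ (intervalBall G o x r).ncard ≤ (n * r + 1) ^ n := by
  let B := separators G x ((hG.normalStep o)^[r] x)
  obtain ⟨hfin, hcard⟩ :=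
    finite_and_ncard_setOf_subset_ncard_le (hG.finite_separators x _ : B.Finite) n
  have hmaps : Set.MapsTo (maxSeparators G x) (intervalBall G o x r) {s | s ⊆ B ∧ s.ncard ≤ n} :=
    fun z hz => ⟨hG.maxSeparators_subset hz, hG.ncard_maxSeparators_le hn x z⟩
  have hinj := hG.injOn_maxSeparators o x r
  refine ⟨hfin.of_injOn hmaps hinj, (Set.ncard_le_ncard_of_injOn _ hmaps hinj hfin).trans ?_⟩
  refine hcard.trans (Nat.pow_le_pow_left (Nat.succ_le_succ ?_) n)
  rw [hG.ncard_separators]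
  exact hG.dist_iterate_normalStep_le hn o x r

theorem shadow_subset_intervalBall (o x : V) {k l : ℕ} (hkl : k ≤ l) :
    hG.shadow o l x k ⊆ intervalBall G o x ((n + 1) * l) := by
  rintro _ ⟨y, hxy : G.dist x y ≤ k, rfl⟩
  refine ⟨hG.separators_iterate_normalStep_subset o ?_, ?_⟩
  · rw [SimpleGraph.dist_comm]
    exact hxy.trans hkl
  · calc G.dist x ((hG.normalStep o)^[l] y)
        ≤ G.dist x y + G.dist y ((hG.normalStep o)^[l] y) := hG.connected.dist_triangle
      _ ≤ l + n * l := add_le_add (hxy.trans hkl) (hG.dist_iterate_normalStep_le hn o y l)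
      _ = (n + 1) * l := by ring

theorem hasPropertyA : @HasPropertyA V (edgePathMetric hG.connected) := by
  let := edgePathMetric hG.connected
  have hdist : ∀ x y : V, dist x y = (G.dist x y : ℝ) := fun _ _ => rfl
  obtain ⟨o⟩ := hG.connected.nonempty
  refine hasPropertyA_of_interleaved (S := hG.shadow o)
    (isLittleO_log_mul_add_one_pow (n * (n + 1)) n) (fun l x k _ => hG.shadow_nonempty o x l k)
    (fun l x k hk => ?_) (fun l x y k R hxy => ?_)
    fun l => ⟨((n + 1) * l : ℕ), fun x k hk z hz => ?_⟩
  · obtain ⟨hfin, hcard⟩ := hG.intervalBall_finite_and_ncard_le hn o x ((n + 1) * l)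
    have hsub := hG.shadow_subset_intervalBall hn o x hk
    rw [mul_assoc]
    exact ⟨hfin.subset hsub, (Set.ncard_le_ncard hsub hfin).trans hcard⟩
  · rw [hdist] at hxy
    exact hG.shadow_subset_shadow o l k (by exact_mod_cast hxy)
  · rw [Metric.mem_closedBall, dist_comm, hdist]
    exact_mod_cast (hG.shadow_subset_intervalBall hn o x hk hz).2

end NormalStep

end IsMedianGraph

end MedianGraph

/-- The vertex of the standard cube that differs from `x` exactly in the `i`-th coordinate. -/
def flipAt {n : ℕ} (x : Fin n → Bool) (i : Fin n) : Fin n → Bool :=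
  Function.update x i (!x i)

section StandardCube

variable {n : ℕ} (x : Fin n → Bool) {i j : Fin n}

@[simp] theorem flipAt_same (i : Fin n) : flipAt x i i = !x i := by simp [flipAt]

theorem flipAt_of_ne (h : j ≠ i) : flipAt x i j = x j := by simp [flipAt, h]

@[simp] theorem flipAt_flipAt (i : Fin n) : flipAt (flipAt x i) i = x := by simp [flipAt]

theorem flipAt_comm (i j : Fin n) : flipAt (flipAt x i) j = flipAt (flipAt x j) i := by
  rcases eq_or_ne i j with rfl | h
  · rfl
  · simp only [flipAt, Function.update_of_ne h, Function.update_of_ne h.symm,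
      Function.update_comm h]

theorem flipAt_ne (i : Fin n) : flipAt x i ≠ x := fun h => by simpa using congrFun h i

theorem flipAt_injective : Function.Injective (flipAt x) := fun i j h => by
  by_contra hij
  simpa [flipAt_of_ne x hij] using congrFun h i

theorem flipAt_flipAt_ne (h : i ≠ j) : flipAt (flipAt x i) j ≠ x := fun e =>
  h (flipAt_injective x (by rw [← flipAt_flipAt (flipAt x i) j, e]))

theorem flipAt_flipAt_ne_flipAt (h : i ≠ j) (k : Fin n) :
    flipAt (flipAt x i) j ≠ flipAt x k := fun e => by
  have hi : k = i := by
    by_contra hki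
    simpa [flipAt_of_ne _ h, flipAt_of_ne x (Ne.symm hki)] using congrFun e i
  have hj : k = j := by
    by_contra hkj
    simpa [flipAt_of_ne x h.symm, flipAt_of_ne x (Ne.symm hkj)] using congrFun e j
  exact h (hi.symm.trans hj)

theorem cubeFace_compl_insert (S : Set (Fin n)) (i : Fin n) :
    cubeFace (insert i S)ᶜ x = cubeFace Sᶜ x ∪ cubeFace Sᶜ (flipAt x i) := by
  ext y
  constructor
  · intro hy
    by_cases hi : y i = x i
    · refine Or.inl fun k hk => ?_
      rcases eq_or_ne k i with rfl | hki
      · exact hi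
      · exact hy k (by simp_all)
    · refine Or.inr fun k hk => ?_
      rcases eq_or_ne k i with rfl | hki
      · rwa [flipAt_same, Bool.eq_not]
      · rw [flipAt_of_ne x hki]
        exact hy k (by simp_all)
  · rintro (hy | hy) k hk <;> rw [Set.mem_compl_iff, Set.mem_insert_iff, not_or] at hk
    · exact hy k hk.2
    · rw [hy k hk.2, flipAt_of_ne x hk.1]

theorem cubeFace_compl_empty : cubeFace ∅ᶜ x = {x} := by
  ext y
  simp [cubeFace, funext_iff]

theorem cubeFace_compl_singleton (i : Fin n) : cubeFace {i}ᶜ x = {x, flipAt x i} := by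
  rw [← insert_empty_eq i, cubeFace_compl_insert, cubeFace_compl_empty, cubeFace_compl_empty,
    Set.singleton_union]

theorem cubeFace_compl_pair (i j : Fin n) :
    cubeFace {i, j}ᶜ x = {x, flipAt x i, flipAt (flipAt x i) j, flipAt x j} := by
  rw [cubeFace_compl_insert, cubeFace_compl_singleton, cubeFace_compl_singleton]
  ext y
  simp only [Set.mem_union, Set.mem_insert_iff, Set.mem_singleton_iff]
  tauto

theorem eq_of_flipAt_eq {α : Type*} {f : (Fin n → Bool) → α} (h : ∀ x i, f (flipAt x i) = f x)
    (x y : Fin n → Bool) : f x = f y := by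
  have key (S : Finset (Fin n)) : ∀ x, y ∈ cubeFace (S : Set (Fin n))ᶜ x → f x = f y := by
    induction S using Finset.induction_on with
    | empty =>
      intro x hy
      rw [Finset.coe_empty, cubeFace_compl_empty] at hy
      rw [Set.mem_singleton_iff.1 hy]
    | insert i S _ ih =>
      intro x hy
      rw [Finset.coe_insert, cubeFace_compl_insert] at hy
      exact hy.elim (ih x) fun hy => (h x i).symm.trans (ih _ hy)
  exact key Finset.univ x (by simp [cubeFace])

end StandardCube

section Charts

variable {V : Type*} {X : CubeComplex V} {n : ℕ} {φ : (Fin n → Bool) → V}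

theorem IsCubeChart.image_cubeFace_mem {K : Set (Set V)} (hφ : IsCubeChart K φ) (S : Set (Fin n))
    (y : Fin n → Bool) : φ '' cubeFace S y ∈ K :=
  (hφ.2 _ (Set.image_subset_range _ _)).2 ⟨S, y, rfl⟩

theorem IsCubeChart.range_mem {K : Set (Set V)} (hφ : IsCubeChart K φ) : Set.range φ ∈ K := by
  simpa [cubeFace] using hφ.image_cubeFace_mem ∅ fun _ => false

theorem IsCubeChart.adj_flipAt (hφ : IsCubeChart X.cubes φ) (x : Fin n → Bool) (i : Fin n) :
    X.edgeGraph.Adj (φ x) (φ (flipAt x i)) := by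
  refine ⟨fun h => flipAt_ne x i (hφ.1 h).symm, ?_⟩
  rw [← Set.image_pair, ← cubeFace_compl_singleton]
  exact hφ.image_cubeFace_mem _ x

theorem IsCubeChart.exists_eq_flipAt_of_adj (hφ : IsCubeChart X.cubes φ) {x : Fin n → Bool} {u : V}
    (hu : u ∈ Set.range φ) (h : X.edgeGraph.Adj (φ x) u) : ∃ i, u = φ (flipAt x i) := by
  obtain ⟨x', rfl⟩ := hu
  obtain ⟨S, y, hS⟩ := (hφ.2 {φ x, φ x'} (by rintro _ (rfl | rfl) <;> exact ⟨_, rfl⟩)).1 h.2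
  have hface : {x, x'} = cubeFace S y := hφ.1.image_injective ((Set.image_pair ..).trans hS)
  have hx : x ∈ cubeFace S y := hface ▸ Set.mem_insert _ _
  have hx' : x' ∈ cubeFace S y := hface ▸ Set.mem_insert_of_mem _ rfl
  obtain ⟨i, hi⟩ := Function.ne_iff.1 fun e : x = x' => h.1 (congrArg φ e)
  have hiS : i ∉ S := fun his => hi ((hx i his).trans (hx' i his).symm)
  have hflip : flipAt x i ∈ ({x, x'} : Set _) := hface ▸ fun k hk => by
    rw [flipAt_of_ne x (ne_of_mem_of_not_mem hk hiS), hx k hk]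
  exact ⟨i, congrArg φ (hflip.resolve_left (flipAt_ne x i)).symm⟩

end Charts

namespace CubeComplex

section Squares

variable {V : Type*} {X : CubeComplex V} {a b c d : V}

/-- The vertices `a, b, c, d`, in this cyclic order, are those of a square (a two-dimensional cube)
of the complex. -/
structure IsSquare (X : CubeComplex V) (a b c d : V) : Prop
    extends IsFourCycle X.edgeGraph a b c d where
  mem : {a, b, c, d} ∈ X.cubes

namespace IsSquare

theorem rotate (h : X.IsSquare a b c d) : X.IsSquare b c d a where
  toIsFourCycle := h.toIsFourCycle.rotate
  mem := by
    convert h.mem using 1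
    ext; simp only [Set.mem_insert_iff, Set.mem_singleton_iff]; tauto

theorem reflect (h : X.IsSquare a b c d) : X.IsSquare a d c b where
  toIsFourCycle := h.toIsFourCycle.reflect
  mem := by
    convert h.mem using 1
    ext; simp only [Set.mem_insert_iff, Set.mem_singleton_iff]; tauto

theorem of_isCubeChart {n : ℕ} {φ : (Fin n → Bool) → V} (hφ : IsCubeChart X.cubes φ)
    (x : Fin n → Bool) {i j : Fin n} (hij : i ≠ j) :
    X.IsSquare (φ x) (φ (flipAt x i)) (φ (flipAt (flipAt x i) j)) (φ (flipAt x j)) where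
  ne_ac e := flipAt_flipAt_ne x hij (hφ.1 e).symm
  ne_bd e := hij (flipAt_injective x (hφ.1 e))
  adj_ab := hφ.adj_flipAt _ _
  adj_bc := hφ.adj_flipAt _ _
  adj_cd := by
    rw [flipAt_comm]
    exact (hφ.adj_flipAt _ _).symm
  adj_da := (hφ.adj_flipAt _ _).symm
  mem := by
    simpa only [cubeFace_compl_pair, Set.image_insert_eq, Set.image_singleton]
      using hφ.image_cubeFace_mem {i, j}ᶜ x

theorem exists_of_mem_cube {C : Set V} (hC : C ∈ X.cubes) (ha : a ∈ C) (hb : b ∈ C) (hd : d ∈ C)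
    (hab : X.edgeGraph.Adj a b) (had : X.edgeGraph.Adj a d) (hbd : b ≠ d) :
    ∃ c ∈ C, X.IsSquare a b c d ∧ ¬ X.edgeGraph.Adj a c := by
  obtain ⟨n, φ, rfl, hφ⟩ := X.exists_chart C hC
  obtain ⟨x, rfl⟩ := ha
  obtain ⟨i, rfl⟩ := hφ.exists_eq_flipAt_of_adj hb hab
  obtain ⟨j, rfl⟩ := hφ.exists_eq_flipAt_of_adj hd had
  have hij : i ≠ j := fun h => hbd (by rw [h])
  refine ⟨_, Set.mem_range_self _, of_isCubeChart hφ x hij, fun h => ?_⟩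
  obtain ⟨k, hk⟩ := hφ.exists_eq_flipAt_of_adj (Set.mem_range_self _) h
  exact flipAt_flipAt_ne_flipAt x hij k (hφ.1 hk)

theorem eq_of_mem {e : V} (he : X.IsSquare a b e d) (hmem : e ∈ ({a, b, c, d} : Set V)) :
    e = c := by
  simpa [he.ne_ac.symm, he.adj_bc.ne', he.adj_cd.ne] using hmem

theorem opposite_unique {c' : V} (h : X.IsSquare a b c d) (h' : X.IsSquare a b c' d) : c = c' := by
  obtain ⟨e, he, hsq, -⟩ := exists_of_mem_cube (a := a) (b := b) (d := d)
    (X.inter_mem _ h.mem _ h'.mem ⟨a, by simp⟩) (by simp) (by simp) (by simp)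
    h.adj_ab h.adj_da.symm h.ne_bd
  exact (hsq.eq_of_mem he.1).symm.trans (hsq.eq_of_mem he.2)

theorem unique {d' : V} (h : X.IsSquare a b c d) (h' : X.IsSquare a b c d') : d = d' :=
  h.rotate.opposite_unique h'.rotate

theorem not_adj_diagonal (h : X.IsSquare a b c d) : ¬ X.edgeGraph.Adj a c := by
  obtain ⟨e, he, hsq, hae⟩ := exists_of_mem_cube (a := a) (b := b) (d := d) h.mem
    (by simp) (by simp) (by simp) h.adj_ab h.adj_da.symm h.ne_bd
  rwa [← hsq.eq_of_mem he]

theorem pair_mem_link (h : X.IsSquare a b c d) : {b, d} ∈ X.link a := by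
  refine ⟨_, h.mem, by simp, Set.ext fun u => ⟨?_, ?_⟩⟩
  · rintro (rfl | rfl)
    · exact ⟨by simp, h.adj_ab⟩
    · exact ⟨by simp, h.adj_da.symm⟩
  · rintro ⟨rfl | rfl | rfl | rfl, hu⟩
    · exact absurd rfl hu.ne
    · exact Or.inl rfl
    · exact absurd hu h.not_adj_diagonal
    · exact Or.inr rfl

end IsSquare

theorem singleton_mem_link {v u : V} (h : X.edgeGraph.Adj v u) : {u} ∈ X.link v := by
  refine ⟨_, h.2, by simp, Set.ext fun w => ⟨?_, ?_⟩⟩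
  · rintro rfl
    exact ⟨Or.inr rfl, h⟩
  · rintro ⟨rfl | rfl, hw⟩
    · exact absurd rfl hw.ne
    · rfl

theorem LinkCondition.exists_chart (hX : X.LinkCondition) {v : V} {A : Set V} (hA : A.Finite)
    (hadj : ∀ u ∈ A, X.edgeGraph.Adj v u)
    (hsq : A.Pairwise fun u w => ∃ t, X.IsSquare v u t w) :
    ∃ (n : ℕ) (φ : (Fin n → Bool) → V) (x : Fin n → Bool), IsCubeChart X.cubes φ ∧ φ x = v ∧
      ∀ u ∈ A, ∃ i, u = φ (flipAt x i) := by
  have hpair : ∀ u ∈ A, ∀ w ∈ A, {u, w} ∈ X.link v := fun u hu w hw => by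
    rcases eq_or_ne u w with rfl | huw
    · simpa using singleton_mem_link (hadj u hu)
    · exact (hsq hu hw huw).choose_spec.pair_mem_link
  obtain ⟨C, hC, hv, hAC⟩ := hX v A hA hpair
  obtain ⟨n, φ, rfl, hφ⟩ := X.exists_chart C hC
  obtain ⟨x, rfl⟩ := hv
  refine ⟨n, φ, x, hφ, rfl, fun u hu => ?_⟩
  rw [hAC] at hu
  exact hφ.exists_eq_flipAt_of_adj hu.1 hu.2

theorem LinkCondition.card_le (hX : X.LinkCondition) {d : ℕ} (hd : ∀ c : X.Cell, c.dim ≤ d)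
    {v : V} {A : Finset V} (hadj : ∀ u ∈ A, X.edgeGraph.Adj v u)
    (hsq : (A : Set V).Pairwise fun u w => ∃ t, X.IsSquare v u t w) : A.card ≤ d := by
  classical
  obtain ⟨n, φ, x, hφ, -, hA⟩ := hX.exists_chart A.finite_toSet hadj hsq
  calc A.card ≤ (Finset.univ.image fun i => φ (flipAt x i)).card :=
        Finset.card_le_card fun u hu => by
          obtain ⟨i, rfl⟩ := hA u hu
          exact Finset.mem_image_of_mem _ (Finset.mem_univ i)
    _ ≤ n := Finset.card_image_le.trans (by simp)
    _ ≤ d := hd ⟨n, φ, hφ⟩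

theorem LinkCondition.exists_cube_of_three_squares (hX : X.LinkCondition)
    {v u₁ u₂ u₃ t₁₂ t₁₃ t₂₃ : V} (h₁₂ : X.IsSquare v u₁ t₁₂ u₂) (h₁₃ : X.IsSquare v u₁ t₁₃ u₃)
    (h₂₃ : X.IsSquare v u₂ t₂₃ u₃) :
    ∃ z, X.IsSquare u₁ t₁₂ z t₁₃ ∧ X.IsSquare u₂ t₁₂ z t₂₃ ∧ X.IsSquare u₃ t₁₃ z t₂₃ := by
  obtain ⟨n, φ, x, hφ, rfl, hA⟩ := hX.exists_chart (v := v) (A := {u₁, u₂, u₃}) (by simp)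
    (by rintro u (rfl | rfl | rfl); exacts [h₁₂.adj_ab, h₂₃.adj_ab, h₂₃.adj_da.symm])
    (by
      have : Std.Symm fun u w => ∃ t, X.IsSquare v u t w := ⟨fun _ _ ⟨t, h⟩ => ⟨t, h.reflect⟩⟩
      rw [Set.pairwise_insert_of_symm, Set.pairwise_pair_of_symm]
      refine ⟨fun _ => ⟨_, h₂₃⟩, ?_⟩
      rintro w (rfl | rfl) -
      exacts [⟨_, h₁₂⟩, ⟨_, h₁₃⟩])
  obtain ⟨i, rfl⟩ := hA u₁ (by simp)
  obtain ⟨j, rfl⟩ := hA u₂ (by simp)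
  obtain ⟨k, rfl⟩ := hA u₃ (by simp)
  have hij : i ≠ j := fun e => h₁₂.ne_bd (by rw [e])
  have hik : i ≠ k := fun e => h₁₃.ne_bd (by rw [e])
  have hjk : j ≠ k := fun e => h₂₃.ne_bd (by rw [e])
  obtain rfl := h₁₂.opposite_unique (.of_isCubeChart hφ x hij)
  obtain rfl := h₁₃.opposite_unique (.of_isCubeChart hφ x hik)
  obtain rfl := h₂₃.opposite_unique (.of_isCubeChart hφ x hjk)
  refine ⟨φ (flipAt (flipAt (flipAt x i) j) k), .of_isCubeChart hφ _ hjk, ?_, ?_⟩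
  · rw [flipAt_comm x i j]
    exact .of_isCubeChart hφ _ hik
  · rw [flipAt_comm _ j k, flipAt_comm x i k, flipAt_comm x j k, flipAt_comm _ i j]
    rw [flipAt_comm _ j i]
    exact .of_isCubeChart hφ _ hij

end Squares

section Swaps

variable {V : Type*} {X : CubeComplex V} {a o u v w : V}

/-- Two edge paths ending at `o` are swap-equivalent if they are related by a sequence of moves,
each replacing two consecutive edges of a square by the two opposite ones. -/
inductive SwapEq (X : CubeComplex V) {o : V} :
    ∀ {v : V}, X.edgeGraph.Walk v o → X.edgeGraph.Walk v o → Prop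
  | refl {v : V} (p : X.edgeGraph.Walk v o) : SwapEq X p p
  | symm {v : V} {p q : X.edgeGraph.Walk v o} : SwapEq X p q → SwapEq X q p
  | trans {v : V} {p q r : X.edgeGraph.Walk v o} : SwapEq X p q → SwapEq X q r → SwapEq X p r
  | cons {a v : V} (h : X.edgeGraph.Adj a v) {p q : X.edgeGraph.Walk v o} :
      SwapEq X p q → SwapEq X (.cons h p) (.cons h q)
  | swap {a v b w : V} (s : X.IsSquare a v b w) (p : X.edgeGraph.Walk b o) :
      SwapEq X (.cons s.adj_ab (.cons s.adj_bc p)) (.cons s.adj_da.symm (.cons s.adj_cd.symm p))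

theorem SwapEq.length_eq {p q : X.edgeGraph.Walk v o} (h : X.SwapEq p q) :
    p.length = q.length := by
  induction h with
  | refl => rfl
  | symm _ ih => exact ih.symm
  | trans _ _ ih ih' => exact ih.trans ih'
  | cons _ _ ih => simp [ih]
  | swap => simp

/-- The trace of swap-equivalence at the first edges of two paths: these edges agree and the rest of
the paths are swap-equivalent, or they span a square and the paths may be swapped to run along it.
Unlike swap-equivalence itself, this can be analysed by cases. -/
inductive Diamond (X : CubeComplex V) {o : V} :
    ∀ {a : V}, X.edgeGraph.Walk a o → X.edgeGraph.Walk a o → Prop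
  | nil : Diamond X .nil .nil
  | same {a v : V} (h : X.edgeGraph.Adj a v) {p q : X.edgeGraph.Walk v o} (hpq : X.SwapEq p q) :
      Diamond X (.cons h p) (.cons h q)
  | square {a v b w : V} (s : X.IsSquare a v b w) (h : X.edgeGraph.Adj a v)
      (h' : X.edgeGraph.Adj a w) {p : X.edgeGraph.Walk v o} {q : X.edgeGraph.Walk w o}
      (r : X.edgeGraph.Walk b o) (hp : X.SwapEq p (.cons s.adj_bc r))
      (hq : X.SwapEq q (.cons s.adj_cd.symm r)) : Diamond X (.cons h p) (.cons h' q)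

theorem Diamond.refl (p : X.edgeGraph.Walk a o) : X.Diamond p p := by
  cases p with
  | nil => exact .nil
  | cons h p => exact .same h (.refl p)

theorem Diamond.symm {p q : X.edgeGraph.Walk a o} (h : X.Diamond p q) : X.Diamond q p := by
  cases h with
  | nil => exact .nil
  | same h hpq => exact .same h hpq.symm
  | square s h h' r hp hq => exact .square s.reflect h' h r hq hp

theorem Diamond.trans (hX : X.LinkCondition) {p₀ p₁ p₂ : X.edgeGraph.Walk a o}
    (ih : ∀ (v : V) (p q : X.edgeGraph.Walk v o), p.length < p₁.length → X.SwapEq p q →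
      X.Diamond p q)
    (h₀ : X.Diamond p₀ p₁) (h₁ : X.Diamond p₁ p₂) : X.Diamond p₀ p₂ := by
  cases h₀ with
  | nil => exact h₁
  | same h hpq =>
    cases h₁ with
    | same _ hqr => exact .same h (hpq.trans hqr)
    | square s _ h' r hq hr => exact .square s h h' r (hpq.trans hq) hr
  | square s₀ h h' r₀ hp hq =>
    cases h₁ with
    | same _ hqr => exact .square s₀ h h' r₀ hp (hqr.symm.trans hq)
    | square s₁ _ h'' r₁ hq' hr =>
      have key := ih _ _ _ (by rw [← hq.length_eq]; simp) (hq.symm.trans hq')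
      generalize hc₀ : SimpleGraph.Walk.cons s₀.adj_cd.symm r₀ = c₀ at key
      generalize hc₁ : SimpleGraph.Walk.cons s₁.adj_bc r₁ = c₁ at key
      cases key with
      | nil => cases hc₀
      | same h₃ hrr =>
        cases hc₀
        cases hc₁
        obtain rfl := s₀.reflect.unique s₁
        exact .same h (hp.trans ((SwapEq.cons _ hrr).trans hr.symm))
      | square s₂ h₃ h₄ t ht ht' =>
        cases hc₀
        cases hc₁
        -- The three squares at the first vertex of the middle path bound a `3`-cube.
        obtain ⟨z, z₀, z₁, z₂⟩ := hX.exists_cube_of_three_squares s₀.rotate.rotate.rotate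
          s₁.rotate.reflect s₂
        refine .square z₀ h h'' (.cons z₁.adj_cd t) ?_ ?_
        · exact hp.trans ((SwapEq.cons _ ht).trans (SwapEq.swap z₁.rotate.reflect t))
        · exact hr.trans ((SwapEq.cons _ ht').trans (SwapEq.swap z₂.rotate.reflect t))

theorem SwapEq.diamond (hX : X.LinkCondition) {p q : X.edgeGraph.Walk a o}
    (h : X.SwapEq p q) : X.Diamond p q := by
  induction hn : p.length using Nat.strong_induction_on generalizing a p q with
  | _ n ih =>
    induction h with
    | refl p => exact .refl p
    | symm h ih' => exact (ih' (h.length_eq.trans hn)).symm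
    | trans h _ ih₀ ih₁ =>
      have hn' := h.length_eq.symm.trans hn
      exact .trans hX (fun v p q hp hpq => ih _ (hn' ▸ hp) hpq rfl) (ih₀ hn) (ih₁ hn')
    | cons h hpq _ => exact .same h hpq
    | swap s p => exact .square s _ _ p (.refl _) (.refl _)

theorem SwapEq.of_cons (hX : X.LinkCondition) {h h' : X.edgeGraph.Adj a v}
    {p q : X.edgeGraph.Walk v o} (hpq : X.SwapEq (.cons h p) (.cons h' q)) : X.SwapEq p q := by
  cases hpq.diamond hX with
  | same _ h => exact h
  | square s => exact absurd rfl s.ne_bd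

theorem SwapEq.exists_isSquare (hX : X.LinkCondition) {h : X.edgeGraph.Adj a v}
    {h' : X.edgeGraph.Adj a w} {p : X.edgeGraph.Walk v o} {q : X.edgeGraph.Walk w o}
    (hpq : X.SwapEq (.cons h p) (.cons h' q)) (hvw : v ≠ w) :
    ∃ (b : V) (s : X.IsSquare a v b w) (r : X.edgeGraph.Walk b o),
      X.SwapEq p (.cons s.adj_bc r) ∧ X.SwapEq q (.cons s.adj_cd.symm r) := by
  cases hpq.diamond hX with
  | same => exact absurd rfl hvw
  | square s _ _ r hp hq => exact ⟨_, s, r, hp, hq⟩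

/-- A path is reduced if no sequence of swaps makes it backtrack. The path is read from its end
`o`, so that extending a reduced path by a first edge only adds a condition on that edge. -/
def IsReduced (X : CubeComplex V) {o : V} : ∀ {v : V}, X.edgeGraph.Walk v o → Prop
  | _, .nil => True
  | a, .cons (v := v) _ p => IsReduced X p ∧
      ¬ ∃ (h' : X.edgeGraph.Adj v a) (q : X.edgeGraph.Walk a o), X.SwapEq p (.cons h' q)

theorem IsReduced.of_swapEq (hX : X.LinkCondition) {p q : X.edgeGraph.Walk v o}
    (hp : X.IsReduced p) (hpq : X.SwapEq p q) : X.IsReduced q := by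
  induction hn : p.length using Nat.strong_induction_on generalizing v p q with
  | _ n ih =>
    cases hpq.diamond hX with
    | nil => exact hp
    | same h hpq' =>
      refine ⟨ih _ (by rw [← hn]; simp) hp.1 hpq' rfl, ?_⟩
      rintro ⟨h', r, hr⟩
      exact hp.2 ⟨h', r, hpq'.trans hr⟩
    | @square _ v b w s h h' p q r hp' hq' =>
      have hr : X.IsReduced (.cons s.adj_bc r) := ih _ (by rw [← hn]; simp) hp.1 hp' rfl
      have hr' : X.IsReduced (.cons s.adj_cd.symm r) := by
        refine ⟨hr.1, ?_⟩
        rintro ⟨h₁, t, ht⟩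
        exact hp.2 ⟨s.adj_ab.symm, .cons s.adj_da.symm t,
          hp'.trans ((SwapEq.cons _ ht).trans (SwapEq.swap s.rotate t))⟩
      have hlt : (SimpleGraph.Walk.cons s.adj_cd.symm r).length < n := by
        have := hp'.length_eq
        simp only [SimpleGraph.Walk.length_cons] at hn this ⊢
        omega
      refine ⟨ih _ hlt hr' hq'.symm rfl, ?_⟩
      rintro ⟨h₁, t, ht⟩
      obtain ⟨c, s', t', hc, -⟩ := SwapEq.exists_isSquare hX (hq'.symm.trans ht) s.ne_ac.symm
      obtain rfl : c = v := s'.opposite_unique s.rotate.rotate.rotate.reflect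
      exact hr.2 ⟨_, t', hc⟩

/-- Up to swaps, one of the paths `p`, `q` is obtained from the other by adding or deleting the
edge `uv` at the start. -/
def Shift (X : CubeComplex V) {o u v : V} (h : X.edgeGraph.Adj u v) (p : X.edgeGraph.Walk u o)
    (q : X.edgeGraph.Walk v o) : Prop :=
  X.SwapEq p (.cons h q) ∨ X.SwapEq q (.cons h.symm p)

namespace Shift

theorem symm {h : X.edgeGraph.Adj u v} {p : X.edgeGraph.Walk u o} {q : X.edgeGraph.Walk v o}
    (hpq : X.Shift h p q) : X.Shift h.symm q p :=
  Or.symm hpq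

theorem congr {h : X.edgeGraph.Adj u v} {p p' : X.edgeGraph.Walk u o}
    {q q' : X.edgeGraph.Walk v o} (hpq : X.Shift h p q) (hp : X.SwapEq p p')
    (hq : X.SwapEq q q') : X.Shift h p' q' := by
  rcases hpq with hpq | hpq
  · exact Or.inl (hp.symm.trans (hpq.trans (.cons _ hq)))
  · exact Or.inr (hq.symm.trans (hpq.trans (.cons _ hp)))

theorem unique (hX : X.LinkCondition) {h : X.edgeGraph.Adj u v} {p : X.edgeGraph.Walk u o}
    {q q' : X.edgeGraph.Walk v o} (hq : X.IsReduced q) (hq' : X.IsReduced q')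
    (hpq : X.Shift h p q) (hpq' : X.Shift h p q') : X.SwapEq q q' := by
  rcases hpq with hpq | hpq <;> rcases hpq' with hpq' | hpq'
  · exact (hpq.symm.trans hpq').of_cons hX
  · exact absurd ⟨_, _, hpq⟩ (hq'.of_swapEq hX hpq').2
  · exact absurd ⟨_, _, hpq'⟩ (hq.of_swapEq hX hpq).2
  · exact hpq.trans hpq'.symm

theorem exists_isReduced (hX : X.LinkCondition) (h : X.edgeGraph.Adj u v)
    {p : X.edgeGraph.Walk u o} (hp : X.IsReduced p) : ∃ q, X.IsReduced q ∧ X.Shift h p q := by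
  by_cases hq : ∃ (h' : X.edgeGraph.Adj u v) (q : X.edgeGraph.Walk v o), X.SwapEq p (.cons h' q)
  · obtain ⟨h', q, hq⟩ := hq
    exact ⟨q, (hp.of_swapEq hX hq).1, Or.inl hq⟩
  · exact ⟨.cons h.symm p, ⟨hp, hq⟩, Or.inr (.refl _)⟩

theorem exists_of_isSquare (hX : X.LinkCondition) {b : V} (s : X.IsSquare u a w b)
    {p : X.edgeGraph.Walk u o} {q : X.edgeGraph.Walk a o} {r : X.edgeGraph.Walk w o}
    (hp : X.IsReduced p) (hr : X.IsReduced r)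
    (hpq : X.Shift s.adj_ab p q) (hqr : X.Shift s.adj_bc q r) :
    ∃ t, X.IsReduced t ∧ X.Shift s.adj_da.symm p t ∧ X.Shift s.adj_cd.symm t r := by
  rcases hpq with hpq | hpq <;> rcases hqr with hqr | hqr
  · have key := hpq.trans ((SwapEq.cons _ hqr).trans (SwapEq.swap s r))
    exact ⟨_, (hp.of_swapEq hX key).1, Or.inl key, Or.inl (.refl _)⟩
  · refine ⟨.cons s.adj_da p, ⟨hp, ?_⟩, Or.inr (.refl _), Or.inl ?_⟩
    · rintro ⟨h', t, ht⟩
      obtain ⟨c, s', t', hc, -⟩ := (hpq.symm.trans ht).exists_isSquare hX s.ne_bd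
      obtain rfl := s'.opposite_unique s
      exact (hr.of_swapEq hX hqr).2 ⟨_, _, hc⟩
    · exact (SwapEq.cons _ hpq).trans ((SwapEq.swap s.rotate.rotate.rotate q).trans
        (.cons _ hqr.symm))
  · obtain ⟨c, s', t, ht, ht'⟩ := (hpq.symm.trans hqr).exists_isSquare hX s.ne_ac
    obtain rfl := s'.opposite_unique s.rotate.reflect
    exact ⟨t, (hp.of_swapEq hX ht).1, Or.inl ht, Or.inr ht'⟩
  · have key := hqr.trans ((SwapEq.cons _ hpq).trans (SwapEq.swap s.rotate.rotate.reflect p))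
    exact ⟨_, (hr.of_swapEq hX key).1, Or.inr (.refl _), Or.inr key⟩

end Shift

end Swaps

section Cocycles

variable {V : Type*} {X : CubeComplex V} {G : Type*} [Group G] {τ : V → V → G} {C : Set V}

/-- One coordinate direction at a time: a potential for the directions in `s` is kept on the facet
`x j = false` and transported along the edges in direction `j` to the opposite facet. -/
theorem exists_potential_of_square_eq {n : ℕ} (τ : (Fin n → Bool) → Fin n → G)
    (hinv : ∀ x i, τ (flipAt x i) i * τ x i = 1)
    (hsq : ∀ x i j, i ≠ j → τ (flipAt x i) j * τ x i = τ (flipAt x j) i * τ x j) :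
    ∃ k : (Fin n → Bool) → G, ∀ x i, k (flipAt x i) = τ x i * k x := by
  suffices H : ∀ s : Finset (Fin n), ∃ k : (Fin n → Bool) → G, ∀ x, ∀ i ∈ s,
      k (flipAt x i) = τ x i * k x by
    obtain ⟨k, hk⟩ := H Finset.univ
    exact ⟨k, fun x i => hk x i (Finset.mem_univ i)⟩
  intro s
  induction s using Finset.induction_on with
  | empty => exact ⟨1, by simp⟩
  | insert j s hj ih =>
    obtain ⟨k, hk⟩ := ih
    refine ⟨fun x => if x j = true then τ (flipAt x j) j * k (flipAt x j) else k x,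
      fun x i hi => ?_⟩
    rcases eq_or_ne i j with rfl | hij
    · cases hx : x i
      · simp [hx]
      · simp [hx, ← mul_assoc, by simpa using hinv (flipAt x i) i]
    · have his : i ∈ s := (Finset.mem_insert.1 hi).resolve_left hij
      simp only [flipAt_of_ne x (Ne.symm hij)]
      split_ifs with hx
      · rw [flipAt_comm, hk _ i his, ← mul_assoc, ← mul_assoc, hsq _ i j hij, flipAt_flipAt]
      · exact hk x i his

/-- `k` is a potential on the cube `C` for the function `τ` on oriented edges: `τ` records how `k`
changes along the edges of `C`. -/
def IsPotential (X : CubeComplex V) (τ : V → V → G) (C : Set V) (k : V → G) : Prop :=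
  ∀ u ∈ C, ∀ v ∈ C, X.edgeGraph.Adj u v → k v = τ u v * k u

theorem IsPotential.mono {D : Set V} {k : V → G} (hk : X.IsPotential τ C k) (hDC : D ⊆ C) :
    X.IsPotential τ D k :=
  fun u hu v hv => hk u (hDC hu) v (hDC hv)

theorem exists_isPotential (hinv : ∀ u v, X.edgeGraph.Adj u v → τ v u * τ u v = 1)
    (hsq : ∀ u a w b, X.IsSquare u a w b → τ a w * τ u a = τ b w * τ u b) (hC : C ∈ X.cubes) :
    ∃ k, X.IsPotential τ C k := by
  obtain ⟨n, φ, rfl, hφ⟩ := X.exists_chart C hC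
  obtain ⟨k, hk⟩ := exists_potential_of_square_eq (fun x i => τ (φ x) (φ (flipAt x i)))
    (fun x i => by simpa using hinv _ _ (hφ.adj_flipAt x i))
    (fun x i j hij => by
      rw [flipAt_comm x j i]
      exact hsq _ _ _ _ (.of_isCubeChart hφ x hij))
  refine ⟨fun v => k (Function.invFun φ v), ?_⟩
  rintro _ ⟨x, rfl⟩ v hv huv
  obtain ⟨i, rfl⟩ := hφ.exists_eq_flipAt_of_adj hv huv
  simp only [Function.leftInverse_invFun hφ.1 _, hk]

theorem IsPotential.mul_inv_eq (hC : C ∈ X.cubes) {k k' : V → G} (hk : X.IsPotential τ C k)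
    (hk' : X.IsPotential τ C k') {u v : V} (hu : u ∈ C) (hv : v ∈ C) :
    k v * (k u)⁻¹ = k' v * (k' u)⁻¹ := by
  obtain ⟨n, φ, rfl, hφ⟩ := X.exists_chart C hC
  obtain ⟨x, rfl⟩ := hu
  obtain ⟨y, rfl⟩ := hv
  have hconst (x i) : (k' (φ (flipAt x i)))⁻¹ * k (φ (flipAt x i)) = (k' (φ x))⁻¹ * k (φ x) := by
    rw [hk _ ⟨x, rfl⟩ _ ⟨_, rfl⟩ (hφ.adj_flipAt x i),
      hk' _ ⟨x, rfl⟩ _ ⟨_, rfl⟩ (hφ.adj_flipAt x i)]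
    group
  have h := eq_of_flipAt_eq (f := fun x => (k' (φ x))⁻¹ * k (φ x)) hconst x y
  rw [inv_mul_eq_iff_eq_mul, ← mul_assoc] at h
  rw [h]
  group

/-- A function on pairs of vertices that is the coboundary of a function on each cube. Only its
values on pairs of vertices in a common cube matter, and there it satisfies the cocycle identity. -/
def IsLocalCoboundary (X : CubeComplex V) (g : V → V → G) : Prop :=
  ∀ C ∈ X.cubes, ∃ k : V → G, ∀ u ∈ C, ∀ v ∈ C, g u v = k v * (k u)⁻¹

theorem IsLocalCoboundary.self {g : V → V → G} (hg : X.IsLocalCoboundary g) (v : V) :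
    g v v = 1 := by
  obtain ⟨k, hk⟩ := hg _ (X.singleton_mem v)
  rw [hk v rfl v rfl, mul_inv_cancel]

theorem IsLocalCoboundary.mul {g : V → V → G} (hg : X.IsLocalCoboundary g) (hC : C ∈ X.cubes)
    {u v w : V} (hu : u ∈ C) (hv : v ∈ C) (hw : w ∈ C) : g v w * g u v = g u w := by
  obtain ⟨k, hk⟩ := hg C hC
  rw [hk u hu v hv, hk v hv w hw, hk u hu w hw]
  group

theorem exists_isLocalCoboundary (hinv : ∀ u v, X.edgeGraph.Adj u v → τ v u * τ u v = 1)
    (hsq : ∀ u a w b, X.IsSquare u a w b → τ a w * τ u a = τ b w * τ u b) :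
    ∃ g : V → V → G, X.IsLocalCoboundary g ∧ ∀ u v, X.edgeGraph.Adj u v → g u v = τ u v := by
  classical
  choose k hk using fun C : X.cubes => exists_isPotential hinv hsq C.2
  let g : V → V → G := fun u v => if h : ∃ C : X.cubes, u ∈ C.1 ∧ v ∈ C.1 then
    k h.choose v * (k h.choose u)⁻¹ else 1
  have hg (C : X.cubes) : ∀ u ∈ C.1, ∀ v ∈ C.1, g u v = k C v * (k C u)⁻¹ := by
    intro u hu v hv
    have h : ∃ C : X.cubes, u ∈ C.1 ∧ v ∈ C.1 := ⟨C, hu, hv⟩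
    simp only [g, dif_pos h]
    exact IsPotential.mul_inv_eq
      (X.inter_mem _ C.2 _ h.choose.2 ⟨u, hu, h.choose_spec.1⟩)
      ((hk _).mono Set.inter_subset_right) ((hk C).mono Set.inter_subset_left)
      ⟨hu, h.choose_spec.1⟩ ⟨hv, h.choose_spec.2⟩
  refine ⟨g, fun C hC => ⟨k ⟨C, hC⟩, hg ⟨C, hC⟩⟩, fun u v huv => ?_⟩
  rw [hg ⟨_, huv.2⟩ u (by simp) v (by simp), hk ⟨_, huv.2⟩ u (by simp) v (by simp) huv,
    mul_inv_cancel_right]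

end Cocycles

section Realization

variable {V : Type*} {X : CubeComplex V} {u v : V}

theorem Cell.continuous_charMap (c : X.Cell) : Continuous c.charMap :=
  continuous_iff_coinduced_le.2 (le_iSup (fun c : X.Cell =>
    TopologicalSpace.coinduced c.charMap inferInstance) c)

theorem isOpen_realization_iff {U : Set X.Realization} :
    IsOpen U ↔ ∀ c : X.Cell, IsOpen (c.charMap ⁻¹' U) :=
  isOpen_iSup_iff.trans (forall_congr' fun _ => isOpen_coinduced)

theorem exists_cell {C : Set V} (hC : C ∈ X.cubes) : ∃ c : X.Cell, Set.range c.vertex = C := by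
  obtain ⟨n, φ, h, hφ⟩ := X.exists_chart C hC
  exact ⟨⟨n, φ, hφ⟩, h⟩

theorem Cell.weight_vertex (c : X.Cell) (t : Fin c.dim → unitInterval) (x : Fin c.dim → Bool) :
    c.weight t (c.vertex x) = ∏ i, (if x i = true then (t i : ℝ) else 1 - (t i : ℝ)) := by
  simp [Cell.weight, c.isChart.1.eq_iff]

theorem Cell.weight_of_notMem (c : X.Cell) (t : Fin c.dim → unitInterval)
    (hv : v ∉ Set.range c.vertex) : c.weight t v = 0 :=
  Finset.sum_eq_zero fun x _ => if_neg fun h => hv ⟨x, h⟩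

/-- The open star of a vertex: the union of the interiors of the cubes that contain it. -/
def openStar (X : CubeComplex V) (v : V) : Set X.Realization := {w | w.1 v ≠ 0}

theorem isOpen_openStar (v : V) : IsOpen (X.openStar v) := by
  refine isOpen_realization_iff.2 fun c => isOpen_ne.preimage (f := fun t => c.weight t v) ?_
  refine continuous_finsetSum _ fun x _ => ?_
  split_ifs
  · refine continuous_finsetProd _ fun i _ => ?_
    split_ifs <;> fun_prop
  · exact continuous_const

theorem Cell.charMap_mem_openStar_iff (c : X.Cell) {t : Fin c.dim → unitInterval}
    {x : Fin c.dim → Bool} :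
    c.charMap t ∈ X.openStar (c.vertex x) ↔ ∀ i, t i ≠ if x i = true then 0 else 1 := by
  change c.weight t (c.vertex x) ≠ 0 ↔ _
  rw [c.weight_vertex, Finset.prod_ne_zero_iff]
  refine ⟨fun h i => ?_, fun h i _ => ?_⟩
  · have := h i (Finset.mem_univ i)
    split_ifs at this ⊢
    · simpa using this
    · rwa [sub_ne_zero, ne_comm, Ne, Set.Icc.coe_eq_one] at this
  · have := h i
    split_ifs at this ⊢
    · simpa using this
    · rwa [sub_ne_zero, ne_comm, Ne, Set.Icc.coe_eq_one]

theorem exists_mem_openStar (w : X.Realization) : ∃ v, w ∈ X.openStar v := by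
  classical
  obtain ⟨_, c, t, rfl⟩ := w
  refine ⟨c.vertex fun i => decide (t i ≠ 0), c.charMap_mem_openStar_iff.2 fun i => ?_⟩
  by_cases h : t i = 0 <;> simp [h]

theorem exists_cube_of_mem_openStar (w : X.Realization) :
    ∃ C ∈ X.cubes, ∀ v, w ∈ X.openStar v → v ∈ C := by
  obtain ⟨_, c, t, rfl⟩ := w
  refine ⟨_, c.isChart.range_mem, fun v hv => ?_⟩
  by_contra h
  exact hv (c.weight_of_notMem t h)

/-- The corner `x` of `{0,1}ⁿ` as a point of `[0,1]ⁿ`. -/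
def corner {n : ℕ} (x : Fin n → Bool) (i : Fin n) : unitInterval := if x i = true then 1 else 0

/-- The straight segment in `[0,1]ⁿ` that runs from the corner `x` at time `0` to the corner `y` at
time `1`. -/
def segment {n : ℕ} (x y : Fin n → Bool) (s : unitInterval) (i : Fin n) : unitInterval :=
  if x i = y i then corner x i else if y i = true then s else unitInterval.symm s

theorem continuous_segment {n : ℕ} (x y : Fin n → Bool) : Continuous (segment x y) := by
  refine continuous_pi fun i => ?_
  unfold segment
  split_ifs <;> fun_prop

theorem segment_zero {n : ℕ} (x y : Fin n → Bool) : segment x y 0 = corner x := by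
  funext i
  cases hx : x i <;> cases hy : y i <;> simp [segment, corner, hx, hy]

theorem segment_one {n : ℕ} (x y : Fin n → Bool) : segment x y 1 = corner y := by
  funext i
  cases hx : x i <;> cases hy : y i <;> simp [segment, corner, hx, hy]

theorem Cell.charMap_segment_mem_openStar_left (c : X.Cell) (x y : Fin c.dim → Bool)
    {s : unitInterval} (hs : s ≠ 1) : c.charMap (segment x y s) ∈ X.openStar (c.vertex x) := by
  refine c.charMap_mem_openStar_iff.2 fun i => ?_
  cases hx : x i <;> cases hy : y i <;> simp [segment, corner, hx, hy, hs]

theorem Cell.charMap_segment_mem_openStar_right (c : X.Cell) (x y : Fin c.dim → Bool)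
    {s : unitInterval} (hs : s ≠ 0) : c.charMap (segment x y s) ∈ X.openStar (c.vertex y) := by
  refine c.charMap_mem_openStar_iff.2 fun i => ?_
  cases hx : x i <;> cases hy : y i <;> simp [segment, corner, hx, hy, hs]

theorem Cell.weight_corner [DecidableEq V] (c : X.Cell) (x : Fin c.dim → Bool) :
    c.weight (corner x) = Pi.single (c.vertex x) 1 := by
  funext v
  by_cases hv : v ∈ Set.range c.vertex
  · obtain ⟨y, rfl⟩ := hv
    rw [c.weight_vertex]
    rcases eq_or_ne y x with rfl | hyx
    · rw [Pi.single_eq_same]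
      refine Finset.prod_eq_one fun i _ => ?_
      cases hy : y i <;> simp [corner, hy]
    · rw [Pi.single_eq_of_ne (c.isChart.1.ne hyx)]
      obtain ⟨i, hi⟩ := Function.ne_iff.1 hyx
      refine Finset.prod_eq_zero (Finset.mem_univ i) ?_
      cases hy : y i <;> cases hx : x i <;> simp_all [corner]
  · rw [c.weight_of_notMem _ hv, Pi.single_eq_of_ne fun h => hv ⟨x, h.symm⟩]

/-- The vertex `v` as a point of the realization: all the weight is on `v`. -/
noncomputable def vertexPoint (X : CubeComplex V) (v : V) : X.Realization :=
  ⟨open Classical in Pi.single v 1, by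
    classical
    obtain ⟨c, hc⟩ := X.exists_cell (X.singleton_mem v)
    obtain ⟨x, hx⟩ : v ∈ Set.range c.vertex := by simp [hc]
    exact ⟨c, corner x, by rw [c.weight_corner, hx]⟩⟩

theorem Cell.charMap_corner (c : X.Cell) (x : Fin c.dim → Bool) :
    c.charMap (corner x) = X.vertexPoint (c.vertex x) := by
  classical
  exact Subtype.ext (c.weight_corner x)

theorem vertexPoint_mem_openStar (v : V) : X.vertexPoint v ∈ X.openStar v := by
  classical
  change (Pi.single v 1 : V → ℝ) v ≠ 0
  simp

theorem exists_edgePath (h : X.edgeGraph.Adj u v) :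
    ∃ γ : Path (X.vertexPoint u) (X.vertexPoint v),
      (∀ s, s ≠ 1 → γ s ∈ X.openStar u) ∧ ∀ s, s ≠ 0 → γ s ∈ X.openStar v := by
  obtain ⟨c, hc⟩ := X.exists_cell h.2
  obtain ⟨x, rfl⟩ : u ∈ Set.range c.vertex := by simp [hc]
  obtain ⟨y, rfl⟩ : v ∈ Set.range c.vertex := by simp [hc]
  exact ⟨{ toFun := fun s => c.charMap (segment x y s)
           continuous_toFun := c.continuous_charMap.comp (continuous_segment x y)
           source' := by rw [segment_zero, c.charMap_corner]
           target' := by rw [segment_one, c.charMap_corner] },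
    fun s hs => c.charMap_segment_mem_openStar_left x y hs,
    fun s hs => c.charMap_segment_mem_openStar_right x y hs⟩

theorem reachable_of_mem_cube {C : Set V} (hC : C ∈ X.cubes) (hu : u ∈ C) (hv : v ∈ C) :
    X.edgeGraph.Reachable u v := by
  obtain ⟨n, φ, rfl, hφ⟩ := X.exists_chart C hC
  obtain ⟨x, rfl⟩ := hu
  obtain ⟨y, rfl⟩ := hv
  refine SimpleGraph.ConnectedComponent.exact <| eq_of_flipAt_eq
    (f := fun x => X.edgeGraph.connectedComponentMk (φ x)) (fun x i => ?_) x y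
  exact SimpleGraph.ConnectedComponent.sound (hφ.adj_flipAt x i).symm.reachable

theorem edgeGraph_connected [ConnectedSpace X.Realization] : X.edgeGraph.Connected := by
  choose σ hσ using exists_mem_openStar (X := X)
  have component_eq (w v) (hv : w ∈ X.openStar v) : X.edgeGraph.connectedComponentMk (σ w) =
      X.edgeGraph.connectedComponentMk v := by
    obtain ⟨C, hC, h⟩ := exists_cube_of_mem_openStar w
    exact SimpleGraph.ConnectedComponent.sound (reachable_of_mem_cube hC (h _ (hσ w)) (h _ hv))
  have hloc : IsLocallyConstant fun w => X.edgeGraph.connectedComponentMk (σ w) :=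
    (IsLocallyConstant.iff_exists_open _).2 fun w =>
      ⟨X.openStar (σ w), isOpen_openStar _, hσ w, fun w' hw' => component_eq w' _ hw'⟩
  refine { preconnected := fun u v => ?_, nonempty := ?_ }
  · have := hloc.apply_eq_of_preconnectedSpace (X.vertexPoint u) (X.vertexPoint v)
    simp only [component_eq _ _ (vertexPoint_mem_openStar _)] at this
    exact SimpleGraph.ConnectedComponent.exact this
  · exact (inferInstance : Nonempty X.Realization).map σ

end Realization

end CubeComplex

section DiscreteBundles

open unitInterval

variable {ι B F : Type*} [TopologicalSpace B] [TopologicalSpace F] [DiscreteTopology F]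
  {Z : FiberBundleCore ι B F}

theorem localTriv_snd_eq {Γ : I → Z.TotalSpace} (hΓ : Continuous Γ) {i : ι} {T : Set I}
    (hT : IsPreconnected T) (hi : ∀ s ∈ T, (Γ s).1 ∈ Z.baseSet i) {s t : I} (hs : s ∈ T)
    (ht : t ∈ T) : (Z.localTriv i (Γ s)).2 = (Z.localTriv i (Γ t)).2 := by
  refine hT.constant (f := fun s => (Z.localTriv i (Γ s)).2) ?_ hs ht
  refine continuous_snd.comp_continuousOn ((Z.localTriv i).continuousOn.comp hΓ.continuousOn ?_)
  exact fun s hs => (Z.mem_localTriv_source i _).2 (hi s hs)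

theorem exists_localTriv_monodromy_eq (cov : IsCoveringMap Z.proj) {x y : B} {i j : ι}
    (γ : Path x y) (hi : ∀ s, s ≠ 1 → γ s ∈ Z.baseSet i) (hj : ∀ s, s ≠ 0 → γ s ∈ Z.baseSet j)
    (e : Z.proj ⁻¹' {x}) : ∃ b ∈ Z.baseSet i ∩ Z.baseSet j,
      (Z.localTriv j (cov.monodromy (.mk γ) e).1).2 =
        Z.coordChange i j b (Z.localTriv i e.1).2 := by
  let Γ := cov.liftPath γ e.1 (γ.source.trans e.2.symm)
  have hΓ0 : Γ 0 = e.1 := cov.liftPath_zero ..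
  have hΓ1 : Γ 1 = (cov.monodromy (.mk γ) e).1 := rfl
  have hΓ (s) : (Γ s).1 = γ s := congrFun (cov.liftPath_lifts γ e.1 _) s
  obtain ⟨m, hm0, hm1⟩ := exists_between (zero_lt_one (α := I))
  have h0 : (Z.localTriv i (Γ 0)).2 = (Z.localTriv i (Γ m)).2 :=
    localTriv_snd_eq Γ.continuous Set.ordConnected_Iio.isPreconnected
      (fun s hs => hΓ s ▸ hi s (ne_of_lt hs)) (hm0.trans hm1) hm1
  have h1 : (Z.localTriv j (Γ m)).2 = (Z.localTriv j (Γ 1)).2 :=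
    localTriv_snd_eq Γ.continuous Set.ordConnected_Ioi.isPreconnected
      (fun s hs => hΓ s ▸ hj s (ne_of_gt hs)) hm0 (hm0.trans hm1)
  have hmi : (Γ m).1 ∈ Z.baseSet i := hΓ m ▸ hi m hm1.ne
  have hmj : (Γ m).1 ∈ Z.baseSet j := hΓ m ▸ hj m hm0.ne'
  refine ⟨(Γ m).1, ⟨hmi, hmj⟩, ?_⟩
  rw [← hΓ0, ← hΓ1, h0, ← h1]
  exact (Z.coordChange_comp _ i j _ ⟨⟨Z.mem_baseSet_at _, hmi⟩, hmj⟩ _).symm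

end DiscreteBundles

namespace CubeComplex

section Sections

variable {V : Type*} {X : CubeComplex V}

/-- The bundle over the realization with discrete fibre `F` that is trivial over each open star and
whose transition functions are the given permutations of `F`. -/
noncomputable def coboundaryBundle {F : Type*} [TopologicalSpace F] [DiscreteTopology F]
    {g : V → V → Equiv.Perm F} (hg : X.IsLocalCoboundary g) :
    FiberBundleCore V X.Realization F where
  baseSet := X.openStar
  isOpen_baseSet := isOpen_openStar
  indexAt w := (exists_mem_openStar w).choose
  mem_baseSet_at w := (exists_mem_openStar w).choose_spec
  coordChange u v _ := g u v
  coordChange_self u _ _ f := by rw [hg.self, Equiv.Perm.one_apply]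
  continuousOn_coordChange u v :=
    ((continuous_of_discreteTopology (f := g u v)).comp continuous_snd).continuousOn
  coordChange_comp u v w x hx f := by
    obtain ⟨C, hC, h⟩ := exists_cube_of_mem_openStar x
    rw [← Equiv.Perm.mul_apply, hg.mul hC (h u hx.1.1) (h v hx.1.2) (h w hx.2)]

theorem IsLocalCoboundary.exists_section [SimplyConnectedSpace X.Realization] {F : Type*}
    {g : V → V → Equiv.Perm F} (hg : X.IsLocalCoboundary g) (o : V) (f₀ : F) :
    ∃ N : V → F, N o = f₀ ∧ ∀ u v, X.edgeGraph.Adj u v → g u v (N u) = N v := by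
  let : TopologicalSpace F := ⊥
  have : DiscreteTopology F := ⟨rfl⟩
  let Z := coboundaryBundle hg
  have cov : IsCoveringMap Z.proj := FiberBundle.isCoveringMap
  let P (v : V) : Path.Homotopic.Quotient (X.vertexPoint o) (X.vertexPoint v) :=
    .mk (PathConnectedSpace.somePath _ _)
  let e₀ : Z.proj ⁻¹' {X.vertexPoint o} :=
    ⟨(Z.localTriv o).toOpenPartialHomeomorph.symm (X.vertexPoint o, f₀), rfl⟩
  have he₀ : Z.localTriv o e₀.1 = (X.vertexPoint o, f₀) :=
    (Z.localTriv o).apply_symm_apply' (vertexPoint_mem_openStar o)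
  refine ⟨fun v => (Z.localTriv v (cov.monodromy (P v) e₀).1).2, ?_, fun u v huv => ?_⟩
  · beta_reduce
    rw [Subsingleton.elim (P o) (.refl _), cov.monodromy_refl, id, he₀]
  · obtain ⟨γ, hγu, hγv⟩ := exists_edgePath huv
    obtain ⟨b, -, hb⟩ := exists_localTriv_monodromy_eq cov γ hγu hγv (cov.monodromy (P u) e₀)
    beta_reduce
    rw [Subsingleton.elim (P v) ((P u).trans (.mk γ)), cov.monodromy_trans_apply, hb]
    rfl

theorem exists_section_of_square_eq [SimplyConnectedSpace X.Realization] {F : V → Type*}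
    (T : ∀ u v, X.edgeGraph.Adj u v → F u ≃ F v)
    (hinv : ∀ u v (h : X.edgeGraph.Adj u v) f, T v u h.symm (T u v h f) = f)
    (hsq : ∀ u a w b (s : X.IsSquare u a w b) f,
      T a w s.adj_bc (T u a s.adj_ab f) = T b w s.adj_cd.symm (T u b s.adj_da.symm f))
    (o : V) (f₀ : F o) :
    ∃ N : ∀ v, F v, N o = f₀ ∧ ∀ u v (h : X.edgeGraph.Adj u v), T u v h (N u) = N v := by
  classical
  have hne (v : V) : Nonempty (F v ≃ F o) := by
    obtain ⟨p⟩ := (edgeGraph_connected (X := X)).preconnected v o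
    clear f₀
    induction p with
    | nil => exact ⟨Equiv.refl _⟩
    | cons h _ ih => exact ih.map fun e => (T _ _ h).trans e
  let b (v : V) : F v ≃ F o := (hne v).some
  let τ (u v : V) : Equiv.Perm (F o) :=
    if h : X.edgeGraph.Adj u v then (b u).symm.trans ((T u v h).trans (b v)) else 1
  have hτ (u v : V) (h : X.edgeGraph.Adj u v) (f) : τ u v f = b v (T u v h ((b u).symm f)) := by
    simp [τ, h]
  obtain ⟨g, hg, hgτ⟩ := exists_isLocalCoboundary (X := X) (τ := τ)
    (fun u v h => Equiv.ext fun f => by simp [hτ u v h, hτ v u h.symm, hinv])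
    (fun u a w b s => Equiv.ext fun f => by
      simp [hτ _ _ s.adj_ab, hτ _ _ s.adj_bc, hτ _ _ s.adj_da.symm, hτ _ _ s.adj_cd.symm,
        hsq u a w b s])
  obtain ⟨N, hN₀, hN⟩ := hg.exists_section o (b o f₀)
  refine ⟨fun v => (b v).symm (N v), by simp [hN₀], fun u v h => ?_⟩
  beta_reduce
  rw [← hN u v h, hgτ u v h, hτ u v h, Equiv.symm_apply_apply]

end Sections

section ReducedPaths

variable {V : Type*} {X : CubeComplex V} {a b d o u v w : V}

/-- Swap-equivalence as a setoid on the reduced paths from `v` to `o`. -/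
def reducedSetoid (X : CubeComplex V) (o v : V) :
    Setoid {p : X.edgeGraph.Walk v o // X.IsReduced p} where
  r p q := X.SwapEq p.1 q.1
  iseqv := ⟨fun p => .refl p.1, .symm, .trans⟩

/-- The swap-equivalence classes of reduced paths from `v` to `o`. They form the local system over
the vertices whose section shows that each class is unique. -/
def ReducedClass (X : CubeComplex V) (o v : V) := Quotient (X.reducedSetoid o v)

/-- The class of a reduced path. -/
def IsReduced.toClass {p : X.edgeGraph.Walk v o} (hp : X.IsReduced p) : X.ReducedClass o v :=
  Quotient.mk _ ⟨p, hp⟩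

theorem IsReduced.toClass_eq_iff {p q : X.edgeGraph.Walk v o} (hp : X.IsReduced p)
    (hq : X.IsReduced q) : hp.toClass = hq.toClass ↔ X.SwapEq p q :=
  Quotient.eq (r := X.reducedSetoid o v)

/-- Moving the starting point of a class of reduced paths along an edge. -/
noncomputable def shiftClass (hX : X.LinkCondition) (o : V) (h : X.edgeGraph.Adj u v) :
    X.ReducedClass o u → X.ReducedClass o v :=
  Quotient.lift (fun p => (Shift.exists_isReduced hX h p.2).choose_spec.1.toClass) fun p q hpq =>
    have hp := (Shift.exists_isReduced hX h p.2).choose_spec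
    have hq := (Shift.exists_isReduced hX h q.2).choose_spec
    (hp.1.toClass_eq_iff hq.1).2 (Shift.unique hX hp.1 hq.1 (hp.2.congr hpq (.refl _)) hq.2)

theorem shiftClass_toClass (hX : X.LinkCondition) {h : X.edgeGraph.Adj u v}
    {p : X.edgeGraph.Walk u o} {q : X.edgeGraph.Walk v o} (hp : X.IsReduced p)
    (hq : X.IsReduced q) (hpq : X.Shift h p q) : shiftClass hX o h hp.toClass = hq.toClass :=
  have hr := (Shift.exists_isReduced hX h hp).choose_spec
  (hr.1.toClass_eq_iff hq).2 (Shift.unique hX hr.1 hq hr.2 hpq)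

theorem shiftClass_symm_shiftClass (hX : X.LinkCondition) (h : X.edgeGraph.Adj u v)
    (f : X.ReducedClass o u) : shiftClass hX o h.symm (shiftClass hX o h f) = f := by
  induction f using Quotient.inductionOn with
  | _ p =>
    obtain ⟨q, hq, hpq⟩ := Shift.exists_isReduced hX h p.2
    exact (congrArg _ (shiftClass_toClass hX p.2 hq hpq)).trans
      (shiftClass_toClass hX hq p.2 hpq.symm)

theorem shiftClass_square (hX : X.LinkCondition) (s : X.IsSquare u a w b)
    (f : X.ReducedClass o u) : shiftClass hX o s.adj_bc (shiftClass hX o s.adj_ab f) =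
      shiftClass hX o s.adj_cd.symm (shiftClass hX o s.adj_da.symm f) := by
  induction f using Quotient.inductionOn with
  | _ p =>
    obtain ⟨q, hq, hpq⟩ := Shift.exists_isReduced hX s.adj_ab p.2
    obtain ⟨r, hr, hqr⟩ := Shift.exists_isReduced hX s.adj_bc hq
    obtain ⟨t, ht, hpt, htr⟩ := Shift.exists_of_isSquare hX s p.2 hr hpq hqr
    change shiftClass hX o s.adj_bc (shiftClass hX o s.adj_ab (IsReduced.toClass p.2)) =
      shiftClass hX o s.adj_cd.symm (shiftClass hX o s.adj_da.symm (IsReduced.toClass p.2))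
    rw [shiftClass_toClass hX p.2 hq hpq, shiftClass_toClass hX hq hr hqr,
      shiftClass_toClass hX p.2 ht hpt, shiftClass_toClass hX ht hr htr]

theorem IsCAT0.swapEq (hX : X.IsCAT0) {p q : X.edgeGraph.Walk v o} (hp : X.IsReduced p)
    (hq : X.IsReduced q) : X.SwapEq p q := by
  have := hX.simplyConnected
  have hL := hX.linkCondition
  have hnil : X.IsReduced (.nil : X.edgeGraph.Walk o o) := trivial
  obtain ⟨N, hN₀, hN⟩ := exists_section_of_square_eq (F := X.ReducedClass o)
    (fun u v h => ⟨shiftClass hL o h, shiftClass hL o h.symm, shiftClass_symm_shiftClass hL h,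
      shiftClass_symm_shiftClass hL h.symm⟩)
    (fun u v h f => shiftClass_symm_shiftClass hL h f)
    (fun u a w b s f => shiftClass_square hL s f) o hnil.toClass
  have key {u : V} (r : X.edgeGraph.Walk u o) (hr : X.IsReduced r) : N u = hr.toClass := by
    clear hp hq p q
    induction r with
    | nil => exact hN₀
    | cons h r ih =>
      rw [← hN _ _ h.symm, ih hnil N hN₀ hN hr.1]
      exact shiftClass_toClass hL hr.1 hr (.inr (.refl _))
  exact (hp.toClass_eq_iff hq).1 ((key p hp).symm.trans (key q hq))

theorem isReduced_of_length_eq_dist {p : X.edgeGraph.Walk v o}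
    (hp : p.length = X.edgeGraph.dist v o) : X.IsReduced p := by
  induction p with
  | nil => trivial
  | @cons a v o h p ih =>
    have hle : X.edgeGraph.dist v o ≤ p.length := SimpleGraph.dist_le p
    rw [SimpleGraph.Walk.length_cons] at hp
    refine ⟨ih ?_, ?_⟩
    · obtain ⟨q, hq⟩ := p.reachable.exists_walk_length_eq_dist
      have := SimpleGraph.dist_le (.cons h q)
      rw [SimpleGraph.Walk.length_cons] at this
      lia
    · rintro ⟨h', q, hq⟩
      have hlen := hq.length_eq
      have := SimpleGraph.dist_le q
      rw [SimpleGraph.Walk.length_cons] at hlen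
      lia

theorem IsCAT0.connected (hX : X.IsCAT0) : X.edgeGraph.Connected :=
  have := hX.simplyConnected
  edgeGraph_connected

theorem IsCAT0.length_eq_dist (hX : X.IsCAT0) {p : X.edgeGraph.Walk v o} (hp : X.IsReduced p) :
    p.length = X.edgeGraph.dist v o := by
  obtain ⟨q, hq⟩ := hX.connected.exists_walk_length_eq_dist v o
  rw [← hq, (hX.swapEq hp (isReduced_of_length_eq_dist hq)).length_eq]

theorem IsCAT0.dist_ne (hX : X.IsCAT0) (o : V) (h : X.edgeGraph.Adj u v) :
    X.edgeGraph.dist u o ≠ X.edgeGraph.dist v o := by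
  obtain ⟨p, hp⟩ := hX.connected.exists_walk_length_eq_dist u o
  obtain ⟨q, hq, hpq⟩ := Shift.exists_isReduced hX.linkCondition h (isReduced_of_length_eq_dist hp)
  rw [← hp, ← hX.length_eq_dist hq]
  rcases hpq with hpq | hpq <;> simp [hpq.length_eq]

theorem IsCAT0.exists_isSquare (hX : X.IsCAT0) (o : V) (hv : X.edgeGraph.Adj a v)
    (hw : X.edgeGraph.Adj a w) (hvw : v ≠ w) (hlv : X.edgeGraph.dist v o < X.edgeGraph.dist a o)
    (hlw : X.edgeGraph.dist w o < X.edgeGraph.dist a o) :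
    ∃ b, X.IsSquare a v b w ∧ X.edgeGraph.dist b o < X.edgeGraph.dist v o := by
  have exists_reduced {u : V} (h : X.edgeGraph.Adj a u)
      (hlt : X.edgeGraph.dist u o < X.edgeGraph.dist a o) :
      ∃ p : X.edgeGraph.Walk u o, p.length = X.edgeGraph.dist u o ∧ X.IsReduced (.cons h p) := by
    obtain ⟨p, hp⟩ := hX.connected.exists_walk_length_eq_dist u o
    refine ⟨p, hp, isReduced_of_length_eq_dist (le_antisymm ?_ (SimpleGraph.dist_le _))⟩
    rwa [SimpleGraph.Walk.length_cons, hp]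
  obtain ⟨p, hp, hap⟩ := exists_reduced hv hlv
  obtain ⟨q, -, haq⟩ := exists_reduced hw hlw
  obtain ⟨b, s, r, hr, -⟩ := (hX.swapEq hap haq).exists_isSquare hX.linkCondition hvw
  refine ⟨b, s, ?_⟩
  rw [← hp, hr.length_eq, SimpleGraph.Walk.length_cons]
  exact Nat.lt_succ_of_le (SimpleGraph.dist_le r)

theorem IsCAT0.isSquare_of_isFourCycle (hX : X.IsCAT0) {c : V}
    (h : IsFourCycle X.edgeGraph a b c d) : X.IsSquare a b c d := by
  have hb : X.edgeGraph.dist b a = 1 := SimpleGraph.dist_eq_one_iff_adj.2 h.adj_ab.symm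
  have hd : X.edgeGraph.dist d a = 1 := SimpleGraph.dist_eq_one_iff_adj.2 h.adj_da
  have hc : 1 < X.edgeGraph.dist c a :=
    lt_of_le_of_ne (hX.connected.pos_dist_of_ne h.ne_ac.symm) (hb ▸ hX.dist_ne a h.adj_bc)
  obtain ⟨e, he, hlt⟩ := hX.exists_isSquare a h.adj_bc.symm h.adj_cd h.ne_bd (hb ▸ hc) (hd ▸ hc)
  obtain rfl : e = a := hX.connected.dist_eq_zero_iff.1 (by lia)
  exact he.rotate.rotate.reflect

theorem IsCAT0.isMedianGraph_edgeGraph (hX : X.IsCAT0) : IsMedianGraph X.edgeGraph where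
  connected := hX.connected
  dist_ne o _ _ := hX.dist_ne o
  exists_fourCycle o _ _ _ hv hw hvw hlv hlw :=
    (hX.exists_isSquare o hv hw hvw hlv hlw).imp fun _ h => ⟨h.1.toIsFourCycle, h.2⟩
  fourCycle_unique h h' :=
    (hX.isSquare_of_isFourCycle h).unique (hX.isSquare_of_isFourCycle h')

theorem IsCAT0.cubeDimLE_edgeGraph (hX : X.IsCAT0) {n : ℕ} (hn : ∀ c : X.Cell, c.dim ≤ n) :
    CubeDimLE X.edgeGraph n := fun _ _ hadj hsq =>
  hX.linkCondition.card_le hn hadj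
    (hsq.imp fun _ _ ⟨t, h⟩ => ⟨t, hX.isSquare_of_isFourCycle h⟩)

end ReducedPaths

end CubeComplex

theorem mainTheorem3 {V : Type*} (X : CubeComplex V) (hX : X.IsCAT0)
    (hdim : X.IsFiniteDimensional) :
    ∃ hconn : X.edgeGraph.Connected, @HasPropertyA V (edgePathMetric hconn) := by
  obtain ⟨n, hn⟩ := hdim
  have hmed : IsMedianGraph X.edgeGraph := hX.isMedianGraph_edgeGraph
  exact ⟨hmed.connected, hmed.hasPropertyA (hX.cubeDimLE_edgeGraph hn)⟩
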